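/- Let $\mathbb T=\{\zeta\in\mathbb C:|\zeta|=1\}$, let $N\in\mathbb N$ and $\kappa\in\mathbb C$ with $\operatorname{Re}\kappa>0$. Let $V$ be a complex-valued potential (a choice of branch on $\mathbb C$), complex differentiable at all but finitely many points of $\mathbb T$, with weight $w=e^{-V}$, such that: * at every $s\in\mathbb T$ the limit of $w(\zeta)$ as $\zeta\to s$, $\zeta\in\mathbb T\setminus\{s\}$, exists in $\mathbb C$ (so $w$ has no jump on $\mathbb T$; in particular its limits for $\arg\zeta\to0^+$ and $\arg\zeta\to2\pi^-$ agree); * for all $m\in\mathbb Z$ and all $z\notin\mathbb T$ at which $V$ is differentiable, the functions $e^{-V(\zeta)}\zeta^m$ and $e^{-V(\zeta)}\frac{\zeta+z}{\zeta-z}[V'(\zeta)-V'(z)]\zeta^m$ are integrable on $\mathbb T$. For a function $f$ on $\mathbb T^N$ put $$\langle f\rangle=\frac1{Z_N}\int_{\mathbb T^N} f(\zeta_1,\dots,\zeta_N)\prod_{j=1}^N w(\zeta_j)\prod_{1\le j<k\le N}|\zeta_j-\zeta_k|^{2\kappa}\prod_{j=1}^N\frac{d\zeta_j}{2\pi i\zeta_j},$$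 where $Z_N$, assumed to be non-zero, is the normalisation for which $\langle1\rangle=1$. The cumulants $\langle A_1\cdots A_n\rangle_c$ are defined by $\langle A_1\cdots A_n\rangle=\sum_\pi\prod_{B\in\pi}\langle \prod_{i\in B}A_i\rangle_c$, the sum being over all set partitions $\pi$ of $\{1,\dots,n\}$ (also for each sub-collection of the $A_i$). With $A(z)=\sum_{j=1}^N\frac{\zeta_j+z}{\zeta_j-z}$ and $A_0(z)=\sum_{j=1}^N\frac{\zeta_j+z}{\zeta_j-z}[V'(\zeta_j)-V'(z)]$ put $$W_n(z_1,\dots,z_n)=\langle A(z_1)\cdots A(z_n)\rangle_c,\qquad P_{n+1}(z;z_1,\dots,z_n)=\langle A_0(z)A(z_1)\cdots A(z_n)\rangle_c .$$ Let $z\in\mathbb C\setminus(\mathbb T\cup\{0\})$ be a point at which $V$ is differentiable. Then the following hold, all derivatives and limits that occur being part of the claim, i.e. they exist. **Second loop equation.** For $z_1\in\mathbb C\setminus(\mathbb T\cup\{0\})$, $z_1\ne z$, $$\begin{aligned} &(\kappa-1)\,\partial_zW_2(z,z_1)-\tfrac12\kappa z^{-1}\left[W_3(z,z,z_1)+2W_1(z)W_2(z,z_1)\right]-P_2(z;z_1)-V'(z)W_2(z,z_1)\\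 &\quad-\frac{\partial}{\partial z_1}\left(\frac{z_1+z}{z_1-z}\left[W_1(z_1)-W_1(z)\right]\right)+\frac1{z_1}\frac{z_1+z}{z_1-z}\left[W_1(z_1)-W_1(z)\right]\\ &\quad+\frac{N-W_1(z)}{z_1}+[\kappa(N-1)+1]\lim_{u\to0}\frac{W_2(u,z_1)}{2u}=0 . \end{aligned}$$ **$(m+1)$-th loop equation, $m\ge2$.** Let $I=(z_1,\dots,z_m)$ with all $z_j\in\mathbb C\setminus(\mathbb T\cup\{0\})$ and $z_j\neq z$. Write $\|$ for concatenation of strings, $I_J$ for the entries of $I$ with position in $J\subseteq\{1,\dots,m\}$ in their original order, $I\setminus I_J$ for the remaining entries and $I\setminus z_j$ for $I$ with its $j$-th entry removed. Then $$\begin{aligned} &(\kappa-1)\,\partial_zW_{m+1}(z\|I)-\tfrac12\kappa z^{-1}\Big(W_{m+2}(z,z\|I)+\sum_{J\subseteq\{1,\dots,m\}}W_{|J|+1}(z\|I_J)\,W_{m-|J|+1}(z\|I\setminus I_J)\Big)\\ &\quad-P_{m+1}(z;I)-V'(z)W_{m+1}(z\|I)\\ &\quad-\sum_{j=1}^m\frac{\partial}{\partial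 z_j}\left(\frac{z_j+z}{z_j-z}\left[W_m(I)-W_m(z\|I\setminus z_j)\right]\right)+\sum_{j=1}^m\frac1{z_j}\frac{z_j+z}{z_j-z}\left[W_m(I)-W_m(z\|I\setminus z_j)\right]\\ &\quad-\sum_{j=1}^m\frac1{z_j}W_m(z\|I\setminus z_j)+\tfrac12[\kappa N+1-\kappa]\lim_{u\to0}\frac{W_{m+1}(u\|I)}{u}=0 . \end{aligned}$$ -/

import Mathlib

open MeasureTheory Filter Topology

noncomputable section

namespace CircularEnsemble

/-- The point `e^{iθ}` of the unit circle. -/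
def pt (θ : ℝ) : ℂ := Complex.exp (θ * Complex.I)

/-- The Riesz-Herglotz kernel `(ζ + z) / (ζ - z)`. -/
def kernel (ζ z : ℂ) : ℂ := (ζ + z) / (ζ - z)

/-- Admissible potentials on the unit circle `𝕋`. Here `V : ℂ → ℂ` is a choice of branch, `V' = deriv V`,
and the weight is `w = exp (-V)`. At a singular point of `V` on `𝕋` (a true singularity, or the crossing of
a branch cut) the value of `V` plays no role, so the regularity of `w` is expressed by punctured limits. -/
structure IsPotential (V : ℂ → ℂ) : Prop where
  /-- There are only finitely many singular points on `𝕋`. -/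
  finite_singular : {ζ : ℂ | ‖ζ‖ = 1 ∧ ¬ DifferentiableAt ℂ V ζ}.Finite
  /-- The weight returns to the same value when `𝕋` is traversed: it has no jump at any point of `𝕋`
  (in particular its limits for `arg ζ → 0+` and `arg ζ → 2π-` agree). -/
  weight_no_jump : ∀ s : ℂ, ‖s‖ = 1 →
    ∃ l : ℂ, Tendsto (fun ζ => Complex.exp (-V ζ)) (𝓝[{ζ : ℂ | ‖ζ‖ = 1} \ {s}] s) (𝓝 l)
  /-- The trigonometric moments of the weight exist. -/
  moments : ∀ m : ℤ, IntegrableOn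
    (fun θ : ℝ => Complex.exp (-V (pt θ)) * pt θ ^ m) (Set.Ioc 0 (2 * Real.pi))
  /-- The trigonometric moments of the weight against the divided difference of `V'` exist. -/
  moments_deriv : ∀ (m : ℤ) (z : ℂ), ‖z‖ ≠ 1 → DifferentiableAt ℂ V z → IntegrableOn
    (fun θ : ℝ => Complex.exp (-V (pt θ)) *
      (kernel (pt θ) z * (deriv V (pt θ) - deriv V z)) * pt θ ^ m) (Set.Ioc 0 (2 * Real.pi))

/-- The unnormalised density `∏ w(ζ_j) ∏_{j<k} |ζ_j - ζ_k|^{2κ}`, with `w = exp (-V)`. -/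
def density (V : ℂ → ℂ) (κ : ℂ) {N : ℕ} (ζ : Fin N → ℂ) : ℂ :=
  (∏ j, Complex.exp (-V (ζ j))) *
    ∏ j, ∏ k ∈ Finset.Ioi j, ((‖ζ j - ζ k‖ : ℝ) : ℂ) ^ (2 * κ)

/-- The integral of `f` times the unnormalised density over `𝕋^N`, with respect to the product of
the measures `dζ_j / (2πi ζ_j) = dθ_j / (2π)`. -/
def gibbsIntegral (V : ℂ → ℂ) (κ : ℂ) (N : ℕ) (f : (Fin N → ℂ) → ℂ) : ℂ :=
  (((2 * Real.pi)⁻¹ : ℝ) : ℂ) ^ N *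
    ∫ θ in Set.univ.pi (fun _ : Fin N => Set.Ioc (0 : ℝ) (2 * Real.pi)),
      f (fun j => pt (θ j)) * density V κ (fun j => pt (θ j))

/-- The normalisation `Z_N`. -/
def partitionZ (V : ℂ → ℂ) (κ : ℂ) (N : ℕ) : ℂ := gibbsIntegral V κ N (fun _ => 1)

/-- The average `⟨f⟩`. -/
def average (V : ℂ → ℂ) (κ : ℂ) (N : ℕ) (f : (Fin N → ℂ) → ℂ) : ℂ :=
  gibbsIntegral V κ N f / partitionZ V κ N

theorem block_card_lt {ι : Type*} [DecidableEq ι] {s : Finset ι} (p : Finpartition s)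
    (hp : p.parts ≠ {s}) {B : Finset ι} (hB : B ∈ p.parts) : B.card < s.card := by
  refine Finset.card_lt_card (lt_of_le_of_ne (p.le hB) ?_)
  rintro rfl
  apply hp
  ext C
  rw [Finset.mem_singleton]
  refine ⟨fun hC => ?_, fun h => h ▸ hB⟩
  by_contra hne
  have hd := p.disjoint hC hB hne
  exact p.ne_bot hC (disjoint_self.mp (hd.mono_right (p.le hC)))

/-- The joint cumulant `⟨∏_{i ∈ s} A_i⟩_c` with respect to the averaging functional `E`: the solution of
`E (∏_{i ∈ s} A_i) = ∑_{set partitions p of s} ∏_{B ∈ p} ⟨∏_{i ∈ B} A_i⟩_c`, solved for the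
term of the one-block partition `{s}`. -/
def jointCumulant {ι Ω : Type*} [DecidableEq ι] (E : (Ω → ℂ) → ℂ) (A : ι → Ω → ℂ)
    (s : Finset ι) : ℂ :=
  E (fun ω => ∏ i ∈ s, A i ω) -
    ∑ p : {p : Finpartition s // p.parts ≠ {s}}, ∏ B : {B : Finset ι // B ∈ p.1.parts},
      jointCumulant E A B.1
termination_by s.card
decreasing_by exact block_card_lt p.1 p.2 B.2

/-- The moment-cumulant relation, which determines the joint cumulants. -/
theorem moment_eq_sum_cumulants {ι Ω : Type*} [DecidableEq ι] (E : (Ω → ℂ) → ℂ)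
    (A : ι → Ω → ℂ) (s : Finset ι) (hs : s.Nonempty) :
    E (fun ω => ∏ i ∈ s, A i ω) =
      ∑ p : Finpartition s, ∏ B ∈ p.parts, jointCumulant E A B := by
  have h := jointCumulant.eq_1 E A s
  have hs' : s ≠ ⊥ := hs.ne_empty
  rw [eq_sub_iff_add_eq] at h
  rw [← h, ← Finset.sum_filter_add_sum_filter_not Finset.univ
    (fun p : Finpartition s => p.parts ≠ {s}), add_comm]
  congr 1
  · rw [← Finset.sum_subtype_eq_sum_filter, Finset.subtype_univ]
    refine Finset.sum_congr rfl fun p _ => ?_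
    exact Finset.prod_coe_sort p.1.parts (jointCumulant E A)
  · have : (Finset.univ.filter (fun p : Finpartition s => ¬ p.parts ≠ {s})) =
        {Finpartition.indiscrete hs'} := by
      ext p
      simp [Finpartition.ext_iff]
    rw [this]
    simp

/-- The linear statistic `A(z) = ∑_j (ζ_j + z) / (ζ_j - z)`. -/
def resolventStat (N : ℕ) (z : ℂ) (ζ : Fin N → ℂ) : ℂ := ∑ j, kernel (ζ j) z

/-- The linear statistic `A₀(z) = ∑_j (ζ_j + z) / (ζ_j - z) [V'(ζ_j) - V'(z)]`. -/
def potentialStat (V : ℂ → ℂ) (N : ℕ) (z : ℂ) (ζ : Fin N → ℂ) : ℂ :=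
  ∑ j, kernel (ζ j) z * (deriv V (ζ j) - deriv V z)

/-- The connected resolvent function `W_n(z_1, …, z_n) = ⟨A(z_1) ⋯ A(z_n)⟩_c`. -/
def W (V : ℂ → ℂ) (κ : ℂ) (N : ℕ) {n : ℕ} (I : Fin n → ℂ) : ℂ :=
  jointCumulant (average V κ N) (fun i : Fin n => resolventStat N (I i)) Finset.univ

/-- The connected potential resolvent function
`P_{n+1}(z; z_1, …, z_n) = ⟨A₀(z) A(z_1) ⋯ A(z_n)⟩_c`. -/
def P (V : ℂ → ℂ) (κ : ℂ) (N : ℕ) {n : ℕ} (z : ℂ) (I : Fin n → ℂ) : ℂ :=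
  jointCumulant (average V κ N)
    (Matrix.vecCons (potentialStat V N z) (fun i : Fin n => resolventStat N (I i))) Finset.univ

/-- The string `z ‖ I_J`: `z` followed by the entries of `I` with position in `J`, in their order. -/
def catSub (z : ℂ) {m : ℕ} (I : Fin m → ℂ) (J : Finset (Fin m)) : Fin (J.card + 1) → ℂ :=
  Matrix.vecCons z (fun i => I (J.orderEmbOfFin rfl i))

end CircularEnsemble

end

open CircularEnsemble MeasureTheory Filter Topology

/-!
The loop equations express that, for a vector field on the torus of configurations, the total
divergence with respect to the density integrates to zero. The field is
`(ζ + z) / (ζ - z) ∂_ζ` in each variable, and it is tested against a product of resolvent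
statistics `A(z_i)`.

**Integration by parts.** The weight has punctured limits everywhere on the circle, so it agrees off
finitely many points with a continuous periodic function whose derivative `-i ζ V' w` is integrable;
the fundamental theorem of calculus off a countable set gives `integral_weight_mul_deriv`, and
Fubini's theorem transfers it to each variable (`integral_torus_partial`). As only `Re κ > 0` is
assumed, the interaction `∏ |ζ_j - ζ_k|^{2κ}` need not be differentiable on the diagonals. It is
replaced by `∏ (|ζ_j - ζ_k|² + ε)^κ`, which is smooth. After summation over the variables, the pair
`(a, b)` contributes a difference `G_a - G_b` of components of the field, which vanishes when the
points collide and so cancels the singularity of the logarithmic derivative; the integrands are then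
dominated uniformly in `ε`, and `ε → 0` gives `integral_divergence`.

**Moments.** For the field above, partial fractions turn the pair sums into linear statistics and
`A(z)²` (`pair_sum_eq`). The outcome is `moment_loop`: for every finite family,
`⟨X ∏ A(z_i)⟩ + ∑_i ⟨Y_i ∏_{l ≠ i} A(z_l)⟩ = 0`, with `X` the statistic `divergenceStat` and `Y_i` the
statistic `transportStat`.

**Cumulants.** Singling out one random variable `X`, the moment-cumulant relation reads
`⟨X A_T⟩ = ∑_{J ⊆ T} ⟨X A_J⟩_c ⟨A_{T \ J}⟩`, a convolution over subsets (`mixedMoment_eq_conv`). Hence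
the cumulants with `X` arise from the mixed moments with `X` by convolution with an inverse which
does not depend on `X`. They are therefore linear in `X`, they may be differentiated in a parameter
of `X`, they vanish for constant `X` on nonempty families, and `moment_loop` turns into
`connected_loop`, an identity of cumulants. The quadratic term is expanded by `adjoinCumulant_mul`.
The limit at `u = 0` is a derivative, because `A(0)` is the constant `N`.
-/

open MeasureTheory Filter Topology

noncomputable section

namespace CircularEnsemble

/-! ### Cumulants and subset convolution -/

/-- A sum over set partitions, grouped according to the block of a fixed element `a`. -/
theorem sum_finpartition_eq_sum_block {ι : Type*} [DecidableEq ι] (K : Finset ι → ℂ)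
    {s : Finset ι} {a : ι} (ha : a ∈ s) :
    ∑ p : Finpartition s, ∏ B ∈ p.parts, K B =
      ∑ B ∈ s.powerset with a ∈ B, K B * ∑ q : Finpartition (s \ B), ∏ C ∈ q.parts, K C := by
  rw [← Finset.sum_fiberwise_of_maps_to (t := s.powerset.filter (a ∈ ·))
    (g := fun p : Finpartition s => p.part a)]
  · refine Finset.sum_congr rfl fun B hB => ?_
    obtain ⟨hBs, haB⟩ := Finset.mem_filter.mp hB
    rw [Finset.mem_powerset] at hBs
    have hB0 : B ≠ ⊥ := Finset.ne_empty_of_mem haB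
    have hdisj : Disjoint (s \ B) B := Finset.sdiff_disjoint
    have hsup : (s \ B) ⊔ B = s := Finset.sdiff_union_of_subset hBs
    have hnot : ∀ q : Finpartition (s \ B), B ∉ q.parts := fun q hq =>
      (Finset.mem_sdiff.mp (q.le hq haB)).2 haB
    rw [Finset.mul_sum]
    symm
    refine Finset.sum_bij (fun q _ => q.extend hB0 hdisj hsup) ?_ ?_ ?_ ?_
    · intro q _
      simp only [Finset.mem_filter, Finset.mem_univ, true_and]
      exact Finpartition.part_eq_of_mem _ (Finset.mem_insert_self _ _) haB
    · intro q _ q' _ h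
      have h' : insert B q.parts = insert B q'.parts := congrArg Finpartition.parts h
      ext1
      rw [← Finset.erase_insert (hnot q), h', Finset.erase_insert (hnot q')]
    · intro p hp
      have hp : p.part a = B := (Finset.mem_filter.mp hp).2
      have hBp : B ∈ p.parts := hp ▸ p.part_mem.mpr ha
      refine ⟨p.ofSubset (Finset.erase_subset B p.parts) (b := s \ B) ?_, Finset.mem_univ _, ?_⟩
      · ext x
        simp only [Finset.mem_sup, Finset.mem_erase, id, Finset.mem_sdiff]
        constructor
        · rintro ⟨C, ⟨hCB, hC⟩, hx⟩
          exact ⟨p.le hC hx, fun hxB => hCB (p.eq_of_mem_parts hC hBp hx hxB)⟩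
        · rintro ⟨hxs, hxB⟩
          obtain ⟨C, hC, hx⟩ := p.exists_mem hxs
          exact ⟨C, ⟨fun h => hxB (h ▸ hx), hC⟩, hx⟩
      · ext1
        exact Finset.insert_erase hBp
    · intro q _
      exact (Finset.prod_insert (hnot q)).symm
  · intro p _
    simp only [Finset.mem_filter, Finset.mem_powerset]
    exact ⟨p.part_subset a, p.mem_part_self.mpr ha⟩

/-- The moment–cumulant relation, with the block of a fixed element `a` singled out. -/
theorem moment_eq_sum_block {ι Ω : Type*} [DecidableEq ι] (E : (Ω → ℂ) → ℂ)
    (hE : E (fun _ => 1) = 1) (A : ι → Ω → ℂ) {s : Finset ι} {a : ι} (ha : a ∈ s) :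
    E (fun ω => ∏ i ∈ s, A i ω) =
      ∑ B ∈ s.powerset with a ∈ B,
        jointCumulant E A B * E (fun ω => ∏ i ∈ s \ B, A i ω) := by
  rw [moment_eq_sum_cumulants E A s ⟨a, ha⟩, sum_finpartition_eq_sum_block _ ha]
  refine Finset.sum_congr rfl fun B _ => ?_
  congr 1
  rcases (s \ B).eq_empty_or_nonempty with h | h
  · have : ∀ t : Finset ι, t = ∅ → ∑ q : Finpartition t, ∏ C ∈ q.parts, jointCumulant E A C =
        E (fun ω => ∏ i ∈ t, A i ω) := by
      rintro t rfl
      have huniv : (Finset.univ : Finset (Finpartition (∅ : Finset ι))) =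
          {Finpartition.empty (Finset ι)} :=
        Finset.eq_singleton_iff_unique_mem.mpr ⟨Finset.mem_univ _, fun q _ => by
          ext1
          exact (Finpartition.parts_eq_empty_iff (P := q)).mpr rfl⟩
      rw [huniv]
      simp [hE]
    exact this _ h
  · exact (moment_eq_sum_cumulants E A _ h).symm

theorem jointCumulant_eq_moment_sub {ι Ω : Type*} [DecidableEq ι] (E : (Ω → ℂ) → ℂ)
    (hE : E (fun _ => 1) = 1) (A : ι → Ω → ℂ) {s : Finset ι} {a : ι} (ha : a ∈ s) :
    jointCumulant E A s = E (fun ω => ∏ i ∈ s, A i ω) -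
      ∑ B ∈ s.ssubsets with a ∈ B,
        jointCumulant E A B * E (fun ω => ∏ i ∈ s \ B, A i ω) := by
  rw [moment_eq_sum_block E hE A ha]
  have h : s.powerset.filter (a ∈ ·) = insert s (s.ssubsets.filter (a ∈ ·)) := by
    ext B
    simp only [Finset.mem_filter, Finset.mem_powerset, Finset.mem_insert, Finset.mem_ssubsets,
      subset_iff_ssubset_or_eq]
    constructor
    · rintro ⟨h | h, h'⟩
      · exact Or.inr ⟨h, h'⟩
      · exact Or.inl h
    · rintro (rfl | ⟨h, h'⟩)
      · exact ⟨Or.inr rfl, ha⟩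
      · exact ⟨Or.inl h, h'⟩
  rw [h, Finset.sum_insert (by simp)]
  simp [hE]

/-- Cumulants depend only on the family of random variables, not on its labelling. -/
theorem jointCumulant_map {ι ι' Ω : Type*} [DecidableEq ι] [DecidableEq ι'] (E : (Ω → ℂ) → ℂ)
    (hE : E (fun _ => 1) = 1) (e : ι ↪ ι') (A : ι → Ω → ℂ) (A' : ι' → Ω → ℂ)
    (hA : ∀ i, A' (e i) = A i) {s : Finset ι} (hs : s.Nonempty) :
    jointCumulant E A' (s.map e) = jointCumulant E A s := by
  induction s using Finset.strongInduction with
  | H s ih =>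
    obtain ⟨a, ha⟩ := hs
    rw [jointCumulant_eq_moment_sub E hE A ha,
      jointCumulant_eq_moment_sub E hE A' (Finset.mem_map_of_mem e ha)]
    congr 1
    · simp [Finset.prod_map, hA]
    · symm
      refine Finset.sum_bij (fun B _ => B.map e) ?_ ?_ ?_ ?_
      · intro B hB
        simp only [Finset.mem_filter, Finset.mem_ssubsets] at hB ⊢
        exact ⟨Finset.map_ssubset_map.mpr hB.1, Finset.mem_map_of_mem e hB.2⟩
      · intro B _ B' _ h
        exact Finset.map_injective e h
      · intro C hC
        simp only [Finset.mem_filter, Finset.mem_ssubsets] at hC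
        obtain ⟨B, hB, rfl⟩ := Finset.subset_map_iff.mp hC.1.subset
        refine ⟨B, ?_, rfl⟩
        simp only [Finset.mem_filter, Finset.mem_ssubsets]
        exact ⟨Finset.map_ssubset_map.mp hC.1, (Finset.mem_map' e).mp hC.2⟩
      · intro B hB
        simp only [Finset.mem_filter, Finset.mem_ssubsets] at hB
        rw [ih B hB.1 ⟨a, hB.2⟩, ← Finset.map_sdiff]
        simp [Finset.prod_map, hA]

/-- Convolution of set functions over the decompositions of a finite set into two parts. -/
def subsetConv {ι : Type*} [DecidableEq ι] (f g : Finset ι → ℂ) (T : Finset ι) : ℂ :=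
  ∑ J ∈ T.powerset, f J * g (T \ J)

theorem subsetConv_comm {ι : Type*} [DecidableEq ι] (f g : Finset ι → ℂ) :
    subsetConv f g = subsetConv g f := by
  funext T
  refine Finset.sum_bij' (fun J _ => T \ J) (fun J _ => T \ J) ?_ ?_ ?_ ?_ ?_
  · intro J _; simp
  · intro J _; simp
  · intro J hJ; exact Finset.sdiff_sdiff_eq_self (Finset.mem_powerset.mp hJ)
  · intro J hJ; exact Finset.sdiff_sdiff_eq_self (Finset.mem_powerset.mp hJ)
  · intro J hJ
    rw [Finset.sdiff_sdiff_eq_self (Finset.mem_powerset.mp hJ), mul_comm]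

theorem subsetConv_assoc {ι : Type*} [DecidableEq ι] (f g h : Finset ι → ℂ) :
    subsetConv (subsetConv f g) h = subsetConv f (subsetConv g h) := by
  funext T
  simp only [subsetConv, Finset.sum_mul, Finset.mul_sum]
  rw [Finset.sum_sigma', Finset.sum_sigma']
  refine Finset.sum_bij' (fun x _ => ⟨x.2, x.1 \ x.2⟩) (fun x _ => ⟨x.1 ∪ x.2, x.1⟩) ?_ ?_ ?_ ?_ ?_
  · rintro ⟨J, K⟩ h
    simp only [Finset.mem_sigma, Finset.mem_powerset] at h ⊢
    exact ⟨h.2.trans h.1, Finset.sdiff_subset_sdiff h.1 le_rfl⟩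
  · rintro ⟨K, L⟩ h
    simp only [Finset.mem_sigma, Finset.mem_powerset] at h ⊢
    exact ⟨Finset.union_subset h.1 (h.2.trans Finset.sdiff_subset), Finset.subset_union_left⟩
  · rintro ⟨J, K⟩ h
    simp only [Finset.mem_sigma, Finset.mem_powerset] at h
    simp [Finset.union_sdiff_of_subset h.2]
  · rintro ⟨K, L⟩ h
    simp only [Finset.mem_sigma, Finset.mem_powerset] at h
    have : Disjoint L K := Finset.disjoint_of_subset_left h.2 Finset.sdiff_disjoint
    simp [Finset.union_sdiff_cancel_left this.symm]
  · rintro ⟨J, K⟩ h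
    simp only [Finset.mem_sigma, Finset.mem_powerset] at h
    have : (T \ K) \ (J \ K) = T \ J := by
      rw [sdiff_sdiff_left, Finset.sup_eq_union, Finset.union_sdiff_of_subset h.2]
    rw [this, mul_assoc]

/-- The unit of subset convolution. -/
def subsetOne {ι : Type*} [DecidableEq ι] (T : Finset ι) : ℂ := if T = ∅ then 1 else 0

theorem subsetConv_one {ι : Type*} [DecidableEq ι] (f : Finset ι → ℂ) :
    subsetConv f subsetOne = f := by
  funext T
  rw [subsetConv, Finset.sum_eq_single T]
  · simp [subsetOne]
  · intro J hJ hne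
    have : T \ J ≠ ∅ := fun h => hne (Finset.Subset.antisymm (Finset.mem_powerset.mp hJ)
      (Finset.sdiff_eq_empty_iff_subset.mp h))
    simp [subsetOne, this]
  · simp

/-- The inverse, for subset convolution, of a set function which is `1` at the empty set. -/
def subsetInv {ι : Type*} [DecidableEq ι] (M : Finset ι → ℂ) (T : Finset ι) : ℂ :=
  if T = ∅ then 1 else -∑ J : {J : Finset ι // J ∈ T.ssubsets}, subsetInv M J.1 * M (T \ J.1)
termination_by T.card
decreasing_by exact Finset.card_lt_card (Finset.mem_ssubsets.mp J.2)

theorem subsetConv_inv {ι : Type*} [DecidableEq ι] (M : Finset ι → ℂ) (hM : M ∅ = 1) :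
    subsetConv M (subsetInv M) = subsetOne := by
  rw [subsetConv_comm]
  funext T
  have h : T.powerset = insert T T.ssubsets :=
    (Finset.insert_erase (Finset.mem_powerset_self T)).symm
  rw [subsetConv, h, Finset.sum_insert (by simp), subsetInv]
  rw [Finset.sum_coe_sort T.ssubsets (fun J => subsetInv M J * M (T \ J))]
  by_cases hT : T = ∅
  · subst hT
    simp [subsetOne, Finset.ssubsets, hM]
  · simp [subsetOne, hT, hM]

/-- The family `X, (A_i)` obtained by adjoining one more random variable to the family `A`; the new
variable has index `none`. -/
def adjoin {ι Ω : Type*} (X : Ω → ℂ) (A : ι → Ω → ℂ) (o : Option ι) : Ω → ℂ := o.elim X A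

/-- The joint cumulant `⟨X ∏_{i ∈ T} A_i⟩_c`. -/
def adjoinCumulant {ι Ω : Type*} [DecidableEq ι] (E : (Ω → ℂ) → ℂ) (A : ι → Ω → ℂ)
    (X : Ω → ℂ) (T : Finset ι) : ℂ :=
  jointCumulant E (adjoin X A) (Finset.insertNone T)

/-- The mixed moment `⟨X ∏_{i ∈ T} A_i⟩`. -/
def mixedMoment {ι Ω : Type*} (E : (Ω → ℂ) → ℂ) (A : ι → Ω → ℂ)
    (X : Ω → ℂ) (T : Finset ι) : ℂ :=
  E (fun ω => X ω * ∏ i ∈ T, A i ω)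

theorem mixedMoment_eq_conv {ι Ω : Type*} [DecidableEq ι] (E : (Ω → ℂ) → ℂ)
    (hE : E (fun _ => 1) = 1) (A : ι → Ω → ℂ) (X : Ω → ℂ) :
    mixedMoment E A X = subsetConv (adjoinCumulant E A X) (mixedMoment E A (fun _ => 1)) := by
  funext T
  have h := moment_eq_sum_block E hE (adjoin X A) (s := Finset.insertNone T) (a := none)
    Finset.none_mem_insertNone
  have hp : ∀ ω, ∏ i ∈ Finset.insertNone T, adjoin X A i ω = X ω * ∏ i ∈ T, A i ω := by
    intro ω
    rw [Finset.prod_insertNone]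
    rfl
  simp only [hp] at h
  rw [mixedMoment, h, subsetConv]
  symm
  refine Finset.sum_bij (fun J _ => Finset.insertNone J) ?_ ?_ ?_ ?_
  · intro J hJ
    simp only [Finset.mem_filter, Finset.mem_powerset] at hJ ⊢
    exact ⟨Finset.insertNone.monotone hJ, Finset.none_mem_insertNone⟩
  · intro J _ J' _ h
    exact Finset.insertNone.injective h
  · intro C hC
    simp only [Finset.mem_filter, Finset.mem_powerset] at hC
    refine ⟨Finset.eraseNone C, ?_, ?_⟩
    · rw [Finset.mem_powerset]
      intro x hx
      exact Finset.some_mem_insertNone.mp (hC.1 (Finset.mem_eraseNone.mp hx))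
    · rw [Finset.insertNone_eraseNone, Finset.insert_eq_of_mem hC.2]
  · intro J _
    have hs : Finset.insertNone T \ Finset.insertNone J = (T \ J).map Function.Embedding.some := by
      ext (_ | x) <;> simp
    rw [hs, adjoinCumulant, mixedMoment]
    simp [Finset.prod_map, adjoin]

theorem adjoinCumulant_eq_conv {ι Ω : Type*} [DecidableEq ι] (E : (Ω → ℂ) → ℂ)
    (hE : E (fun _ => 1) = 1) (A : ι → Ω → ℂ) (X : Ω → ℂ) :
    adjoinCumulant E A X =
      subsetConv (mixedMoment E A X) (subsetInv (mixedMoment E A (fun _ => 1))) := by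
  rw [mixedMoment_eq_conv E hE A X, subsetConv_assoc, subsetConv_inv, subsetConv_one]
  simp [mixedMoment, hE]

theorem adjoinCumulant_one {ι Ω : Type*} [DecidableEq ι] (E : (Ω → ℂ) → ℂ)
    (hE : E (fun _ => 1) = 1) (A : ι → Ω → ℂ) :
    adjoinCumulant E A (fun _ => 1) = subsetOne := by
  rw [adjoinCumulant_eq_conv E hE, subsetConv_inv]
  simp [mixedMoment, hE]

/-- The cumulant of a family containing a product `X X'`, in terms of cumulants of the families
containing `X` and `X'` separately. -/
theorem adjoinCumulant_mul {ι Ω : Type*} [DecidableEq ι] (E : (Ω → ℂ) → ℂ)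
    (hE : E (fun _ => 1) = 1) (A : ι → Ω → ℂ) (X X' : Ω → ℂ) (T : Finset ι) :
    adjoinCumulant E A (fun ω => X ω * X' ω) T =
      adjoinCumulant E (adjoin X' A) X (Finset.insertNone T) +
        ∑ J ∈ T.powerset, adjoinCumulant E A X J * adjoinCumulant E A X' (T \ J) := by
  set M := mixedMoment E A (fun _ => 1) with hM
  have hM1 : M ∅ = 1 := by simp [hM, mixedMoment, hE]
  set k2 : Finset ι → ℂ := fun T => adjoinCumulant E (adjoin X' A) X (Finset.insertNone T)
    with hk2
  have key : mixedMoment E A (fun ω => X ω * X' ω) =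
      fun T => subsetConv (adjoinCumulant E A X) (mixedMoment E A X') T + subsetConv k2 M T := by
    funext T
    have h := congrFun (mixedMoment_eq_conv E hE (adjoin X' A) X) (Finset.insertNone T)
    have hl : mixedMoment E (adjoin X' A) X (Finset.insertNone T) =
        mixedMoment E A (fun ω => X ω * X' ω) T := by
      simp [mixedMoment, Finset.prod_insertNone, adjoin, mul_assoc]
    -- The subsets of the family `X', (A_i)` are split according to whether they contain `X'`.
    rw [← hl, h, subsetConv]
    rw [← Finset.sum_filter_add_sum_filter_not _ (fun C : Finset (Option ι) => none ∉ C)]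
    congr 1
    · symm
      refine Finset.sum_bij (fun J _ => J.map Function.Embedding.some) ?_ ?_ ?_ ?_
      · intro J hJ
        simp only [Finset.mem_filter, Finset.mem_powerset] at hJ ⊢
        refine ⟨?_, by simp⟩
        intro o ho
        obtain ⟨x, hx, rfl⟩ := Finset.mem_map.mp ho
        exact Finset.some_mem_insertNone.mpr (hJ hx)
      · intro J _ J' _ h
        exact Finset.map_injective _ h
      · intro C hC
        simp only [Finset.mem_filter, Finset.mem_powerset] at hC
        refine ⟨Finset.eraseNone C, ?_, ?_⟩
        · rw [Finset.mem_powerset]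
          intro x hx
          exact Finset.some_mem_insertNone.mp (hC.1 (Finset.mem_eraseNone.mp hx))
        · rw [Finset.map_some_eraseNone, Finset.erase_eq_of_notMem hC.2]
      · intro J _
        have hs : Finset.insertNone T \ J.map Function.Embedding.some =
            Finset.insertNone (T \ J) := by
          ext (_ | x) <;> simp
        have h1 : adjoinCumulant E (adjoin X' A) X (J.map Function.Embedding.some) =
            adjoinCumulant E A X J := by
          have he : Finset.insertNone (J.map Function.Embedding.some) =
              (Finset.insertNone J).map
                (Function.Embedding.some : ι ↪ Option ι).optionMap := by
            ext (_ | x) <;> simp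
          rw [adjoinCumulant, he]
          refine jointCumulant_map E hE _ _ _ ?_ ⟨none, by simp⟩
          rintro (_ | x) <;> rfl
        rw [hs, h1]
        simp [mixedMoment, Finset.prod_insertNone, adjoin]
    · symm
      refine Finset.sum_bij (fun J _ => Finset.insertNone J) ?_ ?_ ?_ ?_
      · intro J hJ
        simp only [Finset.mem_filter, Finset.mem_powerset] at hJ ⊢
        exact ⟨Finset.insertNone.monotone hJ, by simp⟩
      · intro J _ J' _ h
        exact Finset.insertNone.injective h
      · intro C hC
        simp only [Finset.mem_filter, Finset.mem_powerset, not_not] at hC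
        refine ⟨Finset.eraseNone C, ?_, ?_⟩
        · rw [Finset.mem_powerset]
          intro x hx
          exact Finset.some_mem_insertNone.mp (hC.1 (Finset.mem_eraseNone.mp hx))
        · rw [Finset.insertNone_eraseNone, Finset.insert_eq_of_mem hC.2]
      · intro J _
        have hs : Finset.insertNone T \ Finset.insertNone J =
            (T \ J).map Function.Embedding.some := by
          ext (_ | x) <;> simp
        rw [hs]
        simp [hk2, hM, mixedMoment, Finset.prod_map, adjoin]
  have key2 : adjoinCumulant E A (fun ω => X ω * X' ω) = fun T =>
      subsetConv (subsetConv (adjoinCumulant E A X) (mixedMoment E A X')) (subsetInv M) T +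
        subsetConv (subsetConv k2 M) (subsetInv M) T := by
    rw [adjoinCumulant_eq_conv E hE, key]
    funext T
    simp only [subsetConv, add_mul, Finset.sum_add_distrib]
    rfl
  rw [key2]
  simp only [subsetConv_assoc]
  rw [subsetConv_inv M hM1, subsetConv_one, ← adjoinCumulant_eq_conv E hE, add_comm]
  rfl

/-- Terms in which one element of the set is distinguished keep that form under convolution. -/
theorem subsetConv_sum_erase {ι : Type*} [DecidableEq ι] (f : ι → Finset ι → ℂ)
    (c : Finset ι → ℂ) (T : Finset ι) :
    subsetConv (fun J => ∑ i ∈ J, f i (J.erase i)) c T =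
      ∑ i ∈ T, subsetConv (f i) c (T.erase i) := by
  simp only [subsetConv, Finset.sum_mul]
  rw [Finset.sum_sigma', Finset.sum_sigma']
  refine Finset.sum_bij' (fun x _ => ⟨x.2, x.1.erase x.2⟩) (fun x _ => ⟨insert x.1 x.2, x.1⟩)
    ?_ ?_ ?_ ?_ ?_
  · rintro ⟨J, i⟩ h
    simp only [Finset.mem_sigma, Finset.mem_powerset] at h ⊢
    exact ⟨h.1 h.2, Finset.erase_subset_erase _ h.1⟩
  · rintro ⟨i, J⟩ h
    simp only [Finset.mem_sigma, Finset.mem_powerset] at h ⊢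
    exact ⟨Finset.insert_subset h.1 (h.2.trans (Finset.erase_subset _ _)),
      Finset.mem_insert_self _ _⟩
  · rintro ⟨J, i⟩ h
    simp only [Finset.mem_sigma, Finset.mem_powerset] at h
    simp [Finset.insert_erase h.2]
  · rintro ⟨i, J⟩ h
    simp only [Finset.mem_sigma, Finset.mem_powerset] at h
    have : i ∉ J := fun hi => Finset.notMem_erase i T (h.2 hi)
    simp [Finset.erase_insert this]
  · rintro ⟨J, i⟩ h
    simp only [Finset.mem_sigma, Finset.mem_powerset] at h
    have : T.erase i \ J.erase i = T \ J := by
      ext x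
      simp only [Finset.mem_sdiff, Finset.mem_erase]
      constructor
      · rintro ⟨⟨h1, h2⟩, h3⟩
        exact ⟨h2, fun hx => h3 ⟨h1, hx⟩⟩
      · rintro ⟨h1, h2⟩
        exact ⟨⟨fun he => h2 (he ▸ h.2), h1⟩, fun hx => h2 hx.2⟩
    rw [this]

/-! ### The weight on the circle -/

theorem norm_pt (θ : ℝ) : ‖pt θ‖ = 1 := Complex.norm_exp_ofReal_mul_I θ

theorem pt_ne_zero (θ : ℝ) : pt θ ≠ 0 := Complex.exp_ne_zero _

theorem hasDerivAt_pt (θ : ℝ) : HasDerivAt pt (Complex.I * pt θ) θ := by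
  have h : HasDerivAt (fun t : ℝ => (t : ℂ) * Complex.I) Complex.I θ := by
    simpa using (Complex.ofRealCLM.hasDerivAt (x := θ)).mul_const Complex.I
  exact h.cexp.congr_deriv (mul_comm _ _)

@[fun_prop]
theorem continuous_pt : Continuous pt :=
  continuous_iff_continuousAt.mpr fun θ => (hasDerivAt_pt θ).continuousAt

theorem pt_two_pi : pt (2 * Real.pi) = pt 0 := by
  simp [pt, Complex.exp_two_pi_mul_I]

/-- The weight `w = exp (-V)` as a function of the angle. -/
def weight (V : ℂ → ℂ) (θ : ℝ) : ℂ := Complex.exp (-V (pt θ))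

/-- The function `w V'` as a function of the angle. -/
def weightDeriv (V : ℂ → ℂ) (θ : ℝ) : ℂ := Complex.exp (-V (pt θ)) * deriv V (pt θ)

theorem countable_singular {V : ℂ → ℂ} (hV : IsPotential V) :
    {θ : ℝ | ¬ DifferentiableAt ℂ V (pt θ)}.Countable := by
  have h : {θ : ℝ | ¬ DifferentiableAt ℂ V (pt θ)} ⊆
      ⋃ ζ ∈ {ζ : ℂ | ‖ζ‖ = 1 ∧ ¬ DifferentiableAt ℂ V ζ}, {θ : ℝ | pt θ = ζ} := by
    intro θ hθ
    simp only [Set.mem_iUnion]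
    exact ⟨pt θ, ⟨norm_pt θ, hθ⟩, rfl⟩
  refine Set.Countable.mono h (hV.finite_singular.countable.biUnion fun ζ _ => ?_)
  by_cases hne : ∃ θ₀, pt θ₀ = ζ
  · obtain ⟨θ₀, rfl⟩ := hne
    refine Set.Countable.mono ?_ (Set.countable_range fun n : ℤ => θ₀ + n * (2 * Real.pi))
    intro θ hθ
    obtain ⟨n, hn⟩ := Complex.exp_eq_exp_iff_exists_int.mp
      (show Complex.exp _ = Complex.exp _ from hθ)
    refine ⟨n, ?_⟩
    have h1 : ((θ : ℂ) - (θ₀ + n * (2 * Real.pi))) * Complex.I = 0 := by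
      linear_combination hn
    have h2 : (θ : ℂ) = ((θ₀ + n * (2 * Real.pi) : ℝ) : ℂ) := by
      push_cast
      exact sub_eq_zero.mp ((mul_eq_zero.mp h1).resolve_right Complex.I_ne_zero)
    exact (Complex.ofReal_injective h2).symm
  · refine Set.Countable.mono (fun θ hθ => ?_) Set.countable_empty
    exact hne ⟨θ, hθ⟩

theorem hasDerivAt_weight {V : ℂ → ℂ} {θ : ℝ} (h : DifferentiableAt ℂ V (pt θ)) :
    HasDerivAt (weight V) (-(Complex.I * pt θ * weightDeriv V θ)) θ := by
  have h1 : HasDerivAt (fun t => V (pt t)) (deriv V (pt θ) * (Complex.I * pt θ)) θ :=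
    h.hasDerivAt.comp θ (hasDerivAt_pt θ)
  have h2 := h1.neg.cexp
  refine h2.congr_deriv ?_
  simp only [weightDeriv, Pi.neg_apply]
  ring

/-- The weight agrees, off the singular points, with a continuous function on the line that takes
the same value at both ends of a period. -/
theorem exists_continuous_weight {V : ℂ → ℂ} (hV : IsPotential V) :
    ∃ w : ℝ → ℂ, Continuous w ∧ w 0 = w (2 * Real.pi) ∧
      ∀ θ, DifferentiableAt ℂ V (pt θ) → w θ = weight V θ := by
  choose! l hl using hV.weight_no_jump
  -- The limit function is the extension of the weight from the dense set of regular angles.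
  set A : Set ℝ := {θ : ℝ | ¬ DifferentiableAt ℂ V (pt θ)}ᶜ with hA
  have hdense : Dense A := (countable_singular hV).dense_compl ℝ
  have hpunct : ∀ θ : ℝ, Tendsto (weight V) (𝓝[≠] θ) (𝓝 (l (pt θ))) := by
    intro θ
    have h1 : Tendsto pt (𝓝[≠] θ) (𝓝[{ζ : ℂ | ‖ζ‖ = 1} \ {pt θ}] (pt θ)) := by
      have h2 := (hasDerivAt_pt θ).tendsto_nhdsNE
        (mul_ne_zero Complex.I_ne_zero (pt_ne_zero θ))
      refine tendsto_nhdsWithin_iff.mpr ⟨tendsto_nhds_of_tendsto_nhdsWithin h2, ?_⟩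
      filter_upwards [(tendsto_nhdsWithin_iff.mp h2).2] with x hx
      exact ⟨norm_pt x, hx⟩
    exact (hl (pt θ) (norm_pt θ)).comp h1
  have heq : ∀ θ, DifferentiableAt ℂ V (pt θ) → l (pt θ) = weight V θ := fun θ h =>
    tendsto_nhds_unique (hpunct θ)
      ((hasDerivAt_weight h).continuousAt.tendsto.mono_left nhdsWithin_le_nhds)
  have hlim : ∀ θ, Tendsto (weight V) (𝓝[A] θ) (𝓝 (l (pt θ))) := by
    intro θ
    by_cases h : DifferentiableAt ℂ V (pt θ)
    · rw [heq θ h]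
      exact (hasDerivAt_weight h).continuousAt.tendsto.mono_left nhdsWithin_le_nhds
    · refine (hpunct θ).mono_left (nhdsWithin_mono θ ?_)
      rintro x hx rfl
      exact hx h
  refine ⟨fun θ => l (pt θ), ?_, by simp [pt_two_pi], heq⟩
  have : (fun θ => l (pt θ)) = extendFrom A (weight V) :=
    funext fun θ => (extendFrom_eq (hdense θ) (hlim θ)).symm
  rw [this]
  exact continuous_extendFrom hdense fun θ => ⟨_, hlim θ⟩

/-- Lebesgue measure on a period of the angle. -/
def angleMeasure : Measure ℝ := volume.restrict (Set.Ioc 0 (2 * Real.pi))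

instance : IsFiniteMeasure angleMeasure := by
  unfold angleMeasure
  infer_instance

theorem integrable_weight {V : ℂ → ℂ} (hV : IsPotential V) :
    Integrable (weight V) angleMeasure := by
  simpa [IntegrableOn, angleMeasure, weight] using! hV.moments 0

theorem sub_ne_zero_of_norm {ζ z : ℂ} (hζ : ‖ζ‖ = 1) (hz : ‖z‖ ≠ 1) : ζ - z ≠ 0 := by
  intro h
  rw [sub_eq_zero] at h
  exact hz (h ▸ hζ)

/-- Multiplying by a continuous function preserves integrability over a period. -/
theorem integrable_mul_continuous {f g : ℝ → ℂ} (hf : Integrable f angleMeasure)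
    (hg : Continuous g) : Integrable (fun θ => f θ * g θ) angleMeasure := by
  have h : IntegrableOn f (Set.Icc 0 (2 * Real.pi)) :=
    (integrableOn_Icc_iff_integrableOn_Ioc).mpr hf
  exact (integrableOn_Icc_iff_integrableOn_Ioc).mp (h.mul_continuousOn hg.continuousOn isCompact_Icc)

theorem integrable_weightDeriv {V : ℂ → ℂ} (hV : IsPotential V) {z : ℂ} (hz : ‖z‖ ≠ 1)
    (hd : DifferentiableAt ℂ V z) : Integrable (weightDeriv V) angleMeasure := by
  have hz' : ‖-z‖ ≠ 1 := by rwa [norm_neg]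
  have h0 := hV.moments_deriv 0 z hz hd
  have h1 : Continuous fun θ => (pt θ - z) / (pt θ + z) := by
    refine Continuous.div (by fun_prop) (by fun_prop) fun θ => ?_
    simpa using sub_ne_zero_of_norm (norm_pt θ) hz'
  -- The kernel has no zero on the circle, so it can be divided out of the assumed integrability.
  have h2 := (integrable_mul_continuous h0 h1).add
    ((integrable_weight hV).const_mul (deriv V z))
  refine h2.congr (Eventually.of_forall fun θ => ?_)
  have ha : pt θ - z ≠ 0 := sub_ne_zero_of_norm (norm_pt θ) hz
  have hb : pt θ + z ≠ 0 := by simpa using sub_ne_zero_of_norm (norm_pt θ) hz'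
  simp only [Pi.add_apply, kernel, weight, weightDeriv, zpow_zero]
  field_simp
  ring

/-- Integration by parts against the weight over a period: the singular points contribute nothing,
since the weight extends continuously over them. -/
theorem integral_weight_mul_deriv {V : ℂ → ℂ} (hV : IsPotential V)
    (hint : Integrable (weightDeriv V) angleMeasure) {s s' : ℝ → ℂ}
    (hs : ∀ θ, HasDerivAt s (s' θ) θ) (hs' : Continuous s') (hper : s 0 = s (2 * Real.pi)) :
    ∫ θ, (weight V θ * s' θ - Complex.I * pt θ * weightDeriv V θ * s θ) ∂angleMeasure = 0 := by
  obtain ⟨w, hwc, hwp, hw⟩ := exists_continuous_weight hV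
  have hsc : Continuous s := continuous_iff_continuousAt.mpr fun θ => (hs θ).continuousAt
  have hpi : (0 : ℝ) ≤ 2 * Real.pi := by positivity
  have hi : Integrable (fun θ => weight V θ * s' θ - Complex.I * pt θ * weightDeriv V θ * s θ)
      angleMeasure := by
    refine (integrable_mul_continuous (integrable_weight hV) hs').sub ?_
    have := integrable_mul_continuous hint (g := fun θ => Complex.I * pt θ * s θ) (by fun_prop)
    refine this.congr (Eventually.of_forall fun θ => ?_)
    simp only
    ring
  have h := MeasureTheory.integral_eq_of_hasDerivAt_off_countable
    (fun θ => w θ * s θ)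
    (fun θ => weight V θ * s' θ - Complex.I * pt θ * weightDeriv V θ * s θ)
    (a := 0) (b := 2 * Real.pi) (countable_singular hV) (hwc.mul hsc).continuousOn ?_
    ((intervalIntegrable_iff_integrableOn_Ioc_of_le hpi).mpr hi)
  · rw [intervalIntegral.integral_of_le hpi] at h
    rw [angleMeasure, h, hwp, hper, sub_self]
  · intro θ hθ
    have hd : DifferentiableAt ℂ V (pt θ) := not_not.mp hθ.2
    have hw' : HasDerivAt w (-(Complex.I * pt θ * weightDeriv V θ)) θ := by
      -- The singular points being finite in number, `w` is the weight on a neighbourhood of `θ`.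
      refine (hasDerivAt_weight hd).congr_of_eventuallyEq ?_
      have hev : ∀ᶠ t in 𝓝 θ, pt t ∈ {ζ : ℂ | ‖ζ‖ = 1 ∧ ¬ DifferentiableAt ℂ V ζ}ᶜ :=
        continuous_pt.continuousAt.eventually
          (hV.finite_singular.isClosed.isOpen_compl.mem_nhds fun h => h.2 hd)
      filter_upwards [hev] with t ht
      exact hw t (not_not.mp fun h => ht ⟨norm_pt t, h⟩)
    refine (hw'.mul (hs θ)).congr_deriv ?_
    rw [hw θ hd]
    ring

/-! ### Integration by parts on the torus -/

/-- Lebesgue measure on a period of each of `N` angles. -/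
def torusMeasure (N : ℕ) : Measure (Fin N → ℝ) := Measure.pi fun _ => angleMeasure

instance (N : ℕ) : IsFiniteMeasure (torusMeasure N) := by
  unfold torusMeasure
  infer_instance

theorem torusMeasure_eq_restrict (N : ℕ) : torusMeasure N =
    volume.restrict (Set.univ.pi fun _ : Fin N => Set.Ioc (0 : ℝ) (2 * Real.pi)) := by
  rw [volume_pi, Measure.restrict_pi_pi]
  rfl

theorem exists_bound_of_continuous {N : ℕ} {g : (Fin N → ℝ) → ℂ} (hg : Continuous g) :
    ∃ C, ∀ᵐ θ ∂torusMeasure N, ‖g θ‖ ≤ C := by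
  have hK : IsCompact (Set.univ.pi fun _ : Fin N => Set.Icc (0 : ℝ) (2 * Real.pi)) :=
    isCompact_univ_pi fun _ => isCompact_Icc
  obtain ⟨C, hC⟩ := hK.exists_bound_of_continuousOn hg.continuousOn
  refine ⟨C, ?_⟩
  rw [torusMeasure_eq_restrict]
  filter_upwards [ae_restrict_mem (MeasurableSet.univ_pi fun _ => measurableSet_Ioc)] with θ hθ
  exact hC θ fun i hi => Set.Ioc_subset_Icc_self (hθ i hi)

theorem integrable_torus_mul_continuous {N : ℕ} {f g : (Fin N → ℝ) → ℂ}
    (hf : Integrable f (torusMeasure N)) (hg : Continuous g) :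
    Integrable (fun θ => f θ * g θ) (torusMeasure N) := by
  obtain ⟨C, hC⟩ := exists_bound_of_continuous hg
  exact hf.mul_bdd hg.aestronglyMeasurable hC

/-- The one-body factor `∏ w(ζ_l)` of the density, as a function of the angles. -/
def weightProd (V : ℂ → ℂ) {N : ℕ} (θ : Fin N → ℝ) : ℂ := ∏ l, weight V (θ l)

theorem integrable_weightProd {V : ℂ → ℂ} (hV : IsPotential V) (N : ℕ) :
    Integrable (weightProd V) (torusMeasure N) :=
  Integrable.fintype_prod fun _ => integrable_weight hV

theorem integrable_weightProd_mul_deriv {V : ℂ → ℂ} (hV : IsPotential V)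
    (hint : Integrable (weightDeriv V) angleMeasure) {N : ℕ} (j : Fin N) :
    Integrable (fun θ => weightProd V θ * deriv V (pt (θ j))) (torusMeasure N) := by
  have h : Integrable (fun θ : Fin N → ℝ =>
      ∏ l, (Function.update (fun _ => weight V) j (weightDeriv V) : Fin N → ℝ → ℂ) l (θ l))
      (torusMeasure N) := by
    refine Integrable.fintype_prod fun l => ?_
    by_cases hl : l = j
    · subst hl; simpa using hint
    · simpa [hl] using integrable_weight hV
  refine h.congr (Eventually.of_forall fun θ => ?_)
  simp only [weightProd]
  rw [← Finset.mul_prod_erase _ _ (Finset.mem_univ j),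
    ← Finset.mul_prod_erase Finset.univ (fun l => weight V (θ l)) (Finset.mem_univ j)]
  have : ∏ x ∈ Finset.univ.erase j,
      (Function.update (fun _ => weight V) j (weightDeriv V) : Fin N → ℝ → ℂ) x (θ x) =
      ∏ x ∈ Finset.univ.erase j, weight V (θ x) :=
    Finset.prod_congr rfl fun l hl => by simp [Finset.ne_of_mem_erase hl]
  rw [this, Function.update_self, weightDeriv, weight]
  ring

/-- The term `w V'` is only known to be integrable, not bounded; it is kept as an integrable factor of
the product over the variables. -/
theorem integrable_divergence_term {V : ℂ → ℂ} (hV : IsPotential V)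
    (hint : Integrable (weightDeriv V) angleMeasure) {N : ℕ} (j : Fin N)
    {S S' : (Fin N → ℝ) → ℂ} (hS : Continuous S) (hS' : Continuous S') :
    Integrable (fun θ => weightProd V θ *
      (S' θ - Complex.I * pt (θ j) * deriv V (pt (θ j)) * S θ)) (torusMeasure N) := by
  have h1 := integrable_torus_mul_continuous (integrable_weightProd hV N) hS'
  have h2 := integrable_torus_mul_continuous (integrable_weightProd_mul_deriv hV hint j)
    (g := fun θ => Complex.I * pt (θ j) * S θ) (by fun_prop)
  refine (h1.sub h2).congr (Eventually.of_forall fun θ => ?_)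
  simp only [Pi.sub_apply]
  ring

/-- Integration by parts in one of the angles, against the one-body factor. -/
theorem integral_torus_partial {V : ℂ → ℂ} (hV : IsPotential V)
    (hint : Integrable (weightDeriv V) angleMeasure) {N : ℕ} (j : Fin N)
    {S S' : (Fin N → ℝ) → ℂ} (hSc : Continuous S) (hSc' : Continuous S')
    (hS : ∀ θ, HasDerivAt (fun x => S (Function.update θ j x)) (S' θ) (θ j))
    (hper : ∀ θ, S (Function.update θ j 0) = S (Function.update θ j (2 * Real.pi))) :
    ∫ θ, weightProd V θ *
      (S' θ - Complex.I * pt (θ j) * deriv V (pt (θ j)) * S θ) ∂torusMeasure N = 0 := by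
  have hI := integrable_divergence_term hV hint j hSc hSc'
  cases N with
  | zero => exact j.elim0
  | succ n =>
    set F : (Fin (n + 1) → ℝ) → ℂ := fun θ => weightProd V θ *
      (S' θ - Complex.I * pt (θ j) * deriv V (pt (θ j)) * S θ) with hF
    have hmp : MeasurePreserving (MeasurableEquiv.piFinSuccAbove (fun _ : Fin (n + 1) => ℝ) j).symm
        (angleMeasure.prod (torusMeasure n)) (torusMeasure (n + 1)) :=
      (measurePreserving_piFinSuccAbove (fun _ : Fin (n + 1) => angleMeasure) j).symm _
    have hI' : Integrable (fun p : ℝ × (Fin n → ℝ) => F (j.insertNth p.1 p.2))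
        (angleMeasure.prod (torusMeasure n)) :=
      (hmp.integrable_comp_emb (MeasurableEquiv.measurableEmbedding _)).mpr hI
    have h1 : ∫ θ, F θ ∂torusMeasure (n + 1) =
        ∫ p : ℝ × (Fin n → ℝ), F (j.insertNth p.1 p.2) ∂angleMeasure.prod (torusMeasure n) :=
      (hmp.integral_comp (MeasurableEquiv.measurableEmbedding _) F).symm
    rw [h1, integral_prod_symm _ hI']
    refine (integral_congr_ae (Eventually.of_forall fun y => ?_)).trans (integral_zero _ _)
    have h2 : ∀ x, F (j.insertNth x y) = weightProd V y *
        (weight V x * S' (j.insertNth x y) -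
          Complex.I * pt x * weightDeriv V x * S (j.insertNth x y)) := by
      intro x
      simp only [hF, weightProd, Fin.prod_univ_succAbove _ j, Fin.insertNth_apply_same,
        Fin.insertNth_apply_succAbove, weightDeriv, weight]
      ring
    simp only [h2, integral_const_mul]
    have hins : Continuous fun x : ℝ => (j.insertNth x y : Fin (n + 1) → ℝ) := by
      fun_prop
    rw [integral_weight_mul_deriv hV hint (s := fun x => S (j.insertNth x y)) ?_
      (s' := fun x => S' (j.insertNth x y)) (hSc'.comp hins) ?_, mul_zero]
    · intro x
      have := hS (j.insertNth x y)
      simpa only [Fin.update_insertNth, Fin.insertNth_apply_same] using this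
    · have := hper (j.insertNth 0 y)
      simpa only [Fin.update_insertNth] using this

/-- The squared distance `|ζ_a - ζ_b|²`, written as a function of the angles. -/
def gap {N : ℕ} (θ : Fin N → ℝ) (a b : Fin N) : ℝ := 2 - 2 * Real.cos (θ a - θ b)

theorem gap_nonneg {N : ℕ} (θ : Fin N → ℝ) (a b : Fin N) : 0 ≤ gap θ a b := by
  have := Real.cos_le_one (θ a - θ b)
  unfold gap
  linarith

theorem gap_le_four {N : ℕ} (θ : Fin N → ℝ) (a b : Fin N) : gap θ a b ≤ 4 := by
  have := Real.neg_one_le_cos (θ a - θ b)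
  unfold gap
  linarith

theorem continuous_gap {N : ℕ} (a b : Fin N) : Continuous fun θ : Fin N → ℝ => gap θ a b := by
  unfold gap
  fun_prop

theorem pt_sub (x y : ℝ) : pt (x - y) = pt x / pt y := by
  simp [pt, sub_mul, Complex.exp_sub]

theorem ofReal_gap {N : ℕ} (θ : Fin N → ℝ) (a b : Fin N) :
    (gap θ a b : ℂ) = -(pt (θ a) - pt (θ b)) ^ 2 / (pt (θ a) * pt (θ b)) := by
  have h1 : Complex.exp (((θ a - θ b : ℝ) : ℂ) * Complex.I) = pt (θ a) / pt (θ b) :=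
    pt_sub _ _
  have h2 : Complex.exp (-((θ a - θ b : ℝ) : ℂ) * Complex.I) = pt (θ b) / pt (θ a) := by
    have := pt_sub (θ b) (θ a)
    rw [← this, pt]
    push_cast
    ring_nf
  have ha := pt_ne_zero (θ a)
  have hb := pt_ne_zero (θ b)
  rw [gap, Complex.ofReal_sub, Complex.ofReal_mul, Complex.ofReal_cos, Complex.cos, h1, h2]
  field_simp
  push_cast
  ring

theorem ofReal_two_sin {N : ℕ} (θ : Fin N → ℝ) (a b : Fin N) :
    ((2 * Real.sin (θ a - θ b) : ℝ) : ℂ) =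
      -Complex.I * (pt (θ a) ^ 2 - pt (θ b) ^ 2) / (pt (θ a) * pt (θ b)) := by
  have h1 : Complex.exp (((θ a - θ b : ℝ) : ℂ) * Complex.I) = pt (θ a) / pt (θ b) :=
    pt_sub _ _
  have h2 : Complex.exp (-((θ a - θ b : ℝ) : ℂ) * Complex.I) = pt (θ b) / pt (θ a) := by
    have := pt_sub (θ b) (θ a)
    rw [← this, pt]
    push_cast
    ring_nf
  have ha := pt_ne_zero (θ a)
  have hb := pt_ne_zero (θ b)
  rw [Complex.ofReal_mul, Complex.ofReal_sin, Complex.sin, h1, h2]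
  field_simp
  push_cast
  ring

theorem norm_sub_sq_eq_gap {N : ℕ} (θ : Fin N → ℝ) (a b : Fin N) :
    ‖pt (θ a) - pt (θ b)‖ ^ 2 = gap θ a b := by
  have h := congrArg norm (ofReal_gap θ a b)
  rw [norm_div, norm_neg, norm_mul, norm_pt, norm_pt, norm_pow, Complex.norm_real,
    Real.norm_of_nonneg (gap_nonneg θ a b)] at h
  rw [h]
  simp

/-- The interaction factor `∏ |ζ_j - ζ_k|^{2κ}` of the density, as a function of the angles. -/
def interaction (κ : ℂ) {N : ℕ} (θ : Fin N → ℝ) : ℂ :=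
  ∏ a, ∏ b ∈ Finset.Ioi a, (gap θ a b : ℂ) ^ κ

theorem density_pt (V : ℂ → ℂ) {κ : ℂ} (hκ : 0 < κ.re) {N : ℕ} (θ : Fin N → ℝ) :
    density V κ (fun j => pt (θ j)) = weightProd V θ * interaction κ θ := by
  have hκ0 : κ ≠ 0 := by
    rintro rfl
    simp at hκ
  unfold density weightProd interaction weight
  congr 1
  refine Finset.prod_congr rfl fun a _ => Finset.prod_congr rfl fun b _ => ?_
  rw [← norm_sub_sq_eq_gap]
  rcases (norm_nonneg (pt (θ a) - pt (θ b))).eq_or_lt with h | h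
  · rw [← h]
    simp [hκ0]
  · rw [sq, Complex.ofReal_mul, Complex.mul_cpow_ofReal_nonneg h.le h.le, two_mul,
      Complex.cpow_add _ _ (by exact_mod_cast h.ne')]

theorem continuous_interaction {κ : ℂ} (hκ : 0 < κ.re) {N : ℕ} :
    Continuous (interaction κ : (Fin N → ℝ) → ℂ) := by
  unfold interaction
  refine continuous_finsetProd _ fun a _ => continuous_finsetProd _ fun b _ => ?_
  exact (Complex.continuous_ofReal_cpow_const hκ).comp (continuous_gap a b)

/-- The regularised interaction factor `∏ (|ζ_j - ζ_k|² + ε)^κ`, which for `ε > 0` is smooth. -/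
def regInteraction (κ : ℂ) (ε : ℝ) {N : ℕ} (θ : Fin N → ℝ) : ℂ :=
  Complex.exp (κ * ∑ a, ∑ b ∈ Finset.Ioi a, (Real.log (gap θ a b + ε) : ℂ))

theorem gap_add_pos {N : ℕ} {ε : ℝ} (hε : 0 < ε) (θ : Fin N → ℝ) (a b : Fin N) :
    0 < gap θ a b + ε := add_pos_of_nonneg_of_pos (gap_nonneg θ a b) hε

theorem continuous_regInteraction (κ : ℂ) {ε : ℝ} (hε : 0 < ε) {N : ℕ} :
    Continuous (regInteraction κ ε : (Fin N → ℝ) → ℂ) := by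
  unfold regInteraction
  refine Complex.continuous_exp.comp (continuous_const.mul ?_)
  refine continuous_finsetSum _ fun a _ => continuous_finsetSum _ fun b _ => ?_
  exact Complex.continuous_ofReal.comp (((continuous_gap a b).add continuous_const).log
    fun θ => (gap_add_pos hε θ a b).ne')

theorem regInteraction_eq_prod (κ : ℂ) {ε : ℝ} (hε : 0 < ε) {N : ℕ} (θ : Fin N → ℝ) :
    regInteraction κ ε θ = ∏ a, ∏ b ∈ Finset.Ioi a, ((gap θ a b + ε : ℝ) : ℂ) ^ κ := by
  unfold regInteraction
  simp only [Finset.mul_sum, Complex.exp_sum]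
  refine Finset.prod_congr rfl fun a _ => Finset.prod_congr rfl fun b _ => ?_
  have h := gap_add_pos hε θ a b
  rw [Complex.cpow_def_of_ne_zero (by exact_mod_cast h.ne'), Complex.ofReal_log h.le, mul_comm]

theorem norm_regInteraction_le {κ : ℂ} (hκ : 0 < κ.re) {ε : ℝ} (hε : 0 < ε) (hε1 : ε ≤ 1)
    {N : ℕ} (θ : Fin N → ℝ) :
    ‖regInteraction κ ε θ‖ ≤
      Real.exp (κ.re * ∑ a : Fin N, ∑ _b ∈ Finset.Ioi a, Real.log 5) := by
  unfold regInteraction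
  rw [Complex.norm_exp]
  have h : (κ * ∑ a, ∑ b ∈ Finset.Ioi a, (Real.log (gap θ a b + ε) : ℂ)).re =
      κ.re * ∑ a, ∑ b ∈ Finset.Ioi a, Real.log (gap θ a b + ε) := by
    have : (∑ a, ∑ b ∈ Finset.Ioi a, (Real.log (gap θ a b + ε) : ℂ)) =
        ((∑ a, ∑ b ∈ Finset.Ioi a, Real.log (gap θ a b + ε) : ℝ) : ℂ) := by
      push_cast
      rfl
    rw [this, Complex.re_mul_ofReal]
  rw [h]
  gcongr with a _ b _
  · exact gap_add_pos hε θ a b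
  · linarith [gap_le_four θ a b]

theorem tendsto_regInteraction {κ : ℂ} (hκ : 0 < κ.re) {N : ℕ} (θ : Fin N → ℝ) :
    Tendsto (fun ε : ℝ => regInteraction κ ε θ) (𝓝[>] 0) (𝓝 (interaction κ θ)) := by
  have h : Tendsto (fun ε : ℝ => ∏ a, ∏ b ∈ Finset.Ioi a, ((gap θ a b + ε : ℝ) : ℂ) ^ κ)
      (𝓝[>] 0) (𝓝 (interaction κ θ)) := by
    refine tendsto_finsetProd _ fun a _ => tendsto_finsetProd _ fun b _ => ?_
    have hc : Continuous fun ε : ℝ => ((gap θ a b + ε : ℝ) : ℂ) ^ κ :=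
      (Complex.continuous_ofReal_cpow_const hκ).comp (by fun_prop)
    simpa using (hc.tendsto 0).mono_left nhdsWithin_le_nhds
  refine h.congr' ?_
  filter_upwards [self_mem_nhdsWithin] with ε hε
  exact (regInteraction_eq_prod κ hε θ).symm

/-- At a collision the ratio is `0` and does not tend to `1`, but there the interaction vanishes, so the
limit holds at every configuration. -/
theorem tendsto_regInteraction_mul {κ : ℂ} (hκ : 0 < κ.re) {N : ℕ} (θ : Fin N → ℝ)
    (a b : Fin N) (hab : a < b) :
    Tendsto (fun ε : ℝ => regInteraction κ ε θ * ((gap θ a b / (gap θ a b + ε) : ℝ) : ℂ))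
      (𝓝[>] 0) (𝓝 (interaction κ θ)) := by
  by_cases h : gap θ a b = 0
  · have hκ0 : κ ≠ 0 := by
      rintro rfl
      simp at hκ
    have h0 : interaction κ θ = 0 :=
      Finset.prod_eq_zero (Finset.mem_univ a)
        (Finset.prod_eq_zero (Finset.mem_Ioi.mpr hab) (by simp [h, hκ0]))
    simp [h, h0]
  · have hc : Tendsto (fun ε : ℝ => ((gap θ a b / (gap θ a b + ε) : ℝ) : ℂ)) (𝓝[>] 0) (𝓝 1) := by
      have h1 : ContinuousAt (fun ε : ℝ => ((gap θ a b / (gap θ a b + ε) : ℝ) : ℂ)) 0 := by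
        refine Complex.continuous_ofReal.continuousAt.comp ?_
        exact continuousAt_const.div (by fun_prop) (by simpa using h)
      have h2 := h1.tendsto.mono_left (nhdsWithin_le_nhds (s := Set.Ioi 0))
      simpa [h] using h2
    simpa using (tendsto_regInteraction hκ θ).mul hc

theorem hasDerivAt_update_apply {N : ℕ} (θ : Fin N → ℝ) (j a : Fin N) (x : ℝ) :
    HasDerivAt (fun x => Function.update θ j x a) (if a = j then 1 else 0) x := by
  by_cases h : a = j
  · subst h
    simpa using hasDerivAt_id' x
  · simpa [h] using hasDerivAt_const x (θ a)

theorem hasDerivAt_regInteraction (κ : ℂ) {ε : ℝ} (hε : 0 < ε) {N : ℕ} (θ : Fin N → ℝ)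
    (j : Fin N) :
    HasDerivAt (fun x => regInteraction κ ε (Function.update θ j x))
      (regInteraction κ ε θ * (κ * ∑ a, ∑ b ∈ Finset.Ioi a,
        ((2 * Real.sin (θ a - θ b) : ℝ) : ℂ) / ((gap θ a b + ε : ℝ) : ℂ) *
          ((if a = j then 1 else 0) - (if b = j then 1 else 0)))) (θ j) := by
  have h1 : ∀ a b, HasDerivAt (fun x => (Real.log (gap (Function.update θ j x) a b + ε) : ℂ))
      (((2 * Real.sin (θ a - θ b) : ℝ) : ℂ) / ((gap θ a b + ε : ℝ) : ℂ) *
          ((if a = j then 1 else 0) - (if b = j then 1 else 0))) (θ j) := by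
    intro a b
    have h2 := ((((hasDerivAt_update_apply θ j a (θ j)).sub
      (hasDerivAt_update_apply θ j b (θ j))).cos.const_mul 2).const_sub 2).add_const ε
    have h3 := (h2.log (by
      simpa [gap] using (gap_add_pos hε θ a b).ne')).ofReal_comp
    refine h3.congr_deriv ?_
    simp only [Pi.sub_apply, Function.update_eq_self, gap]
    push_cast
    split_ifs <;> simp
    ring
  have h4 : HasDerivAt (fun x => ∑ a, ∑ b ∈ Finset.Ioi a,
      (Real.log (gap (Function.update θ j x) a b + ε) : ℂ)) _ (θ j) :=
    HasDerivAt.fun_sum fun a _ => HasDerivAt.fun_sum fun b _ => h1 a b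
  have h5 := (h4.const_mul κ).cexp
  simp only [Function.update_eq_self] at h5
  exact h5

theorem pt_update_period {N : ℕ} (θ : Fin N → ℝ) (j i : Fin N) :
    pt (Function.update θ j 0 i) = pt (Function.update θ j (2 * Real.pi) i) := by
  by_cases h : i = j
  · subst h
    simp [pt_two_pi]
  · simp [h]

theorem regInteraction_update_period (κ : ℂ) (ε : ℝ) {N : ℕ} (θ : Fin N → ℝ) (j : Fin N) :
    regInteraction κ ε (Function.update θ j 0) =
      regInteraction κ ε (Function.update θ j (2 * Real.pi)) := by
  simp only [regInteraction, ← norm_sub_sq_eq_gap, pt_update_period]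

/-- Summing `G_j` times the `j`-th partial derivative of a function of the differences collects, for
each pair, the difference of the components of `G`. -/
theorem sum_sum_Ioi_delta {N : ℕ} (G : Fin N → ℂ) (t : Fin N → Fin N → ℂ) :
    ∑ j, G j * ∑ a, ∑ b ∈ Finset.Ioi a,
        t a b * ((if a = j then 1 else 0) - (if b = j then 1 else 0)) =
      ∑ a, ∑ b ∈ Finset.Ioi a, t a b * (G a - G b) := by
  simp only [Finset.mul_sum]
  rw [Finset.sum_comm]
  refine Finset.sum_congr rfl fun a _ => ?_
  rw [Finset.sum_comm]
  refine Finset.sum_congr rfl fun b _ => ?_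
  have h : ∀ j, G j * (t a b * ((if a = j then 1 else 0) - (if b = j then 1 else 0))) =
      (if a = j then t a b * G j else 0) - (if b = j then t a b * G j else 0) := by
    intro j
    split_ifs <;> ring
  simp only [h, Finset.sum_sub_distrib, Finset.sum_ite_eq, Finset.mem_univ, if_true]
  ring

/-- The divergence identity for the regularised interaction. Contributions of the interaction are
collected pair by pair. Since `2 sin (θ_a - θ_b)` is the derivative of the gap in `θ_a`, the
hypothesis on `R` says that the contribution of a pair to the derivative of the logarithm of the
interaction extends continuously to the collisions. -/
theorem integral_divergence_reg {V : ℂ → ℂ} (hV : IsPotential V)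
    (hint : Integrable (weightDeriv V) angleMeasure) (κ : ℂ) {ε : ℝ} (hε : 0 < ε) {N : ℕ}
    {G G' : Fin N → (Fin N → ℝ) → ℂ} {R : Fin N → Fin N → (Fin N → ℝ) → ℂ}
    (hGc : ∀ j, Continuous (G j)) (hGc' : ∀ j, Continuous (G' j))
    (hG : ∀ j θ, HasDerivAt (fun x => G j (Function.update θ j x)) (G' j θ) (θ j))
    (hper : ∀ j θ, G j (Function.update θ j 0) = G j (Function.update θ j (2 * Real.pi)))
    (hR : ∀ a b θ, (G a θ - G b θ) * ((2 * Real.sin (θ a - θ b) : ℝ) : ℂ) =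
      gap θ a b * R a b θ) :
    ∫ θ, weightProd V θ * (regInteraction κ ε θ *
      (∑ j, (G' j θ - Complex.I * pt (θ j) * deriv V (pt (θ j)) * G j θ) +
        κ * ∑ a, ∑ b ∈ Finset.Ioi a, ((gap θ a b / (gap θ a b + ε) : ℝ) : ℂ) * R a b θ))
      ∂torusMeasure N = 0 := by
  set D : Fin N → (Fin N → ℝ) → ℂ := fun j θ => κ * ∑ a, ∑ b ∈ Finset.Ioi a,
    ((2 * Real.sin (θ a - θ b) : ℝ) : ℂ) / ((gap θ a b + ε : ℝ) : ℂ) *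
      ((if a = j then 1 else 0) - (if b = j then 1 else 0)) with hD
  have hDc : ∀ j, Continuous (D j) := by
    intro j
    refine continuous_const.mul (continuous_finsetSum _ fun a _ =>
      continuous_finsetSum _ fun b _ => Continuous.mul ?_ continuous_const)
    refine Continuous.div (by fun_prop)
      (Complex.continuous_ofReal.comp ((continuous_gap a b).add continuous_const)) fun θ => ?_
    exact_mod_cast (gap_add_pos hε θ a b).ne'
  have hreg : Continuous (regInteraction κ ε : (Fin N → ℝ) → ℂ) := continuous_regInteraction κ hε
  have hSc : ∀ j, Continuous fun θ => G j θ * regInteraction κ ε θ := fun j => (hGc j).mul hreg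
  have hSc' : ∀ j, Continuous fun θ => G' j θ * regInteraction κ ε θ +
      G j θ * (regInteraction κ ε θ * D j θ) := fun j =>
    ((hGc' j).mul hreg).add ((hGc j).mul (hreg.mul (hDc j)))
  have hj := fun j => integral_torus_partial hV hint j (hSc j) (hSc' j) (fun θ => by
      have h := (hG j θ).mul (hasDerivAt_regInteraction κ hε θ j)
      simp only [Function.update_eq_self] at h
      exact h) (fun θ => by
      simp only [hper j θ, regInteraction_update_period κ ε θ j])
  have hsum := Finset.sum_eq_zero (s := Finset.univ) fun j _ => hj j
  rw [← integral_finsetSum _ fun j _ => integrable_divergence_term hV hint j (hSc j) (hSc' j)]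
    at hsum
  refine Eq.trans (integral_congr_ae (Eventually.of_forall fun θ => ?_)) hsum
  have hpair : ∑ j, G j θ * D j θ =
      κ * ∑ a, ∑ b ∈ Finset.Ioi a, ((gap θ a b / (gap θ a b + ε) : ℝ) : ℂ) * R a b θ := by
    have h := sum_sum_Ioi_delta (fun j => G j θ) fun a b =>
      ((2 * Real.sin (θ a - θ b) : ℝ) : ℂ) / ((gap θ a b + ε : ℝ) : ℂ)
    have h' : ∑ j, G j θ * D j θ = κ * ∑ j, G j θ * ∑ a, ∑ b ∈ Finset.Ioi a,
        ((2 * Real.sin (θ a - θ b) : ℝ) : ℂ) / ((gap θ a b + ε : ℝ) : ℂ) *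
          ((if a = j then 1 else 0) - (if b = j then 1 else 0)) := by
      rw [Finset.mul_sum]
      refine Finset.sum_congr rfl fun j _ => ?_
      simp only [hD]
      ring
    rw [h', h]
    congr 1
    refine Finset.sum_congr rfl fun a _ => Finset.sum_congr rfl fun b _ => ?_
    rw [div_mul_eq_mul_div, mul_comm _ (G a θ - G b θ), hR, Complex.ofReal_div]
    ring
  simp only
  rw [← hpair, ← Finset.mul_sum, ← Finset.sum_add_distrib, Finset.mul_sum]
  congr 1
  refine Finset.sum_congr rfl fun j _ => ?_
  ring

/-- The divergence identity for the full interaction, by letting the regularisation tend to zero.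
No integrability of the derivative of the interaction is needed: the limit is taken after the
contributions of the pairs have been collected, when the integrands are uniformly dominated. -/
theorem integral_divergence {V : ℂ → ℂ} (hV : IsPotential V)
    (hint : Integrable (weightDeriv V) angleMeasure) {κ : ℂ} (hκ : 0 < κ.re) {N : ℕ}
    {G G' : Fin N → (Fin N → ℝ) → ℂ} {R : Fin N → Fin N → (Fin N → ℝ) → ℂ}
    (hGc : ∀ j, Continuous (G j)) (hGc' : ∀ j, Continuous (G' j))
    (hRc : ∀ a b, Continuous (R a b))
    (hG : ∀ j θ, HasDerivAt (fun x => G j (Function.update θ j x)) (G' j θ) (θ j))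
    (hper : ∀ j θ, G j (Function.update θ j 0) = G j (Function.update θ j (2 * Real.pi)))
    (hR : ∀ a b θ, (G a θ - G b θ) * ((2 * Real.sin (θ a - θ b) : ℝ) : ℂ) =
      gap θ a b * R a b θ) :
    ∫ θ, weightProd V θ * interaction κ θ *
      (∑ j, (G' j θ - Complex.I * pt (θ j) * deriv V (pt (θ j)) * G j θ) +
        κ * ∑ a, ∑ b ∈ Finset.Ioi a, R a b θ) ∂torusMeasure N = 0 := by
  set Q : (Fin N → ℝ) → ℂ := fun θ =>
    ∑ j, (G' j θ - Complex.I * pt (θ j) * deriv V (pt (θ j)) * G j θ) with hQ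
  set C : ℝ := Real.exp (κ.re * ∑ a : Fin N, ∑ _b ∈ Finset.Ioi a, Real.log 5) with hC
  have hQi : Integrable (fun θ => weightProd V θ * Q θ) (torusMeasure N) := by
    simp only [hQ, Finset.mul_sum]
    exact integrable_finsetSum _ fun j _ =>
      integrable_divergence_term hV hint j (hGc j) (hGc' j)
  have hRi : ∀ a b, Integrable (fun θ => weightProd V θ * R a b θ) (torusMeasure N) := fun a b =>
    integrable_torus_mul_continuous (integrable_weightProd hV N) (hRc a b)
  set F : ℝ → (Fin N → ℝ) → ℂ := fun ε θ => weightProd V θ * (regInteraction κ ε θ *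
      (Q θ + κ * ∑ a, ∑ b ∈ Finset.Ioi a,
        ((gap θ a b / (gap θ a b + ε) : ℝ) : ℂ) * R a b θ)) with hF
  have hFeq : ∀ ε θ, F ε θ = regInteraction κ ε θ * (weightProd V θ * Q θ) +
      κ * ∑ a, ∑ b ∈ Finset.Ioi a,
        (regInteraction κ ε θ * ((gap θ a b / (gap θ a b + ε) : ℝ) : ℂ)) *
          (weightProd V θ * R a b θ) := by
    intro ε θ
    simp only [hF, mul_add, Finset.mul_sum]
    congr 1
    · ring
    · refine Finset.sum_congr rfl fun a _ => Finset.sum_congr rfl fun b _ => ?_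
      ring
  have hratio : ∀ {ε : ℝ}, 0 < ε → ∀ θ : Fin N → ℝ, ∀ a b,
      ‖((gap θ a b / (gap θ a b + ε) : ℝ) : ℂ)‖ ≤ 1 := by
    intro ε hε θ a b
    rw [Complex.norm_real, Real.norm_of_nonneg
      (div_nonneg (gap_nonneg θ a b) (gap_add_pos hε θ a b).le)]
    exact div_le_one_of_le₀ (by linarith) (gap_add_pos hε θ a b).le
  have hpos : ∀ᶠ ε : ℝ in 𝓝[>] 0, 0 < ε ∧ ε ≤ 1 := by
    filter_upwards [Ioc_mem_nhdsGT (zero_lt_one (α := ℝ))] with ε hε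
    exact hε
  have hlim : Tendsto (fun ε => ∫ θ, F ε θ ∂torusMeasure N) (𝓝[>] 0)
      (𝓝 (∫ θ, weightProd V θ * interaction κ θ *
        (Q θ + κ * ∑ a, ∑ b ∈ Finset.Ioi a, R a b θ) ∂torusMeasure N)) := by
    refine tendsto_integral_filter_of_dominated_convergence
      (fun θ => C * ‖weightProd V θ * Q θ‖ +
        ‖κ‖ * ∑ a, ∑ b ∈ Finset.Ioi a, C * ‖weightProd V θ * R a b θ‖) ?_ ?_ ?_ ?_
    · filter_upwards [hpos] with ε hε
      have hreg : Continuous (regInteraction κ ε : (Fin N → ℝ) → ℂ) :=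
        continuous_regInteraction κ hε.1
      simp only [funext (hFeq ε)]
      refine (hreg.aestronglyMeasurable.mul hQi.1).add (AEStronglyMeasurable.const_mul ?_ κ)
      refine Finset.aestronglyMeasurable_fun_sum _ fun a _ =>
        Finset.aestronglyMeasurable_fun_sum _ fun b _ => ?_
      refine AEStronglyMeasurable.mul (Continuous.aestronglyMeasurable ?_) (hRi a b).1
      refine hreg.mul (Complex.continuous_ofReal.comp ?_)
      exact (continuous_gap a b).div ((continuous_gap a b).add continuous_const)
        fun θ => (gap_add_pos hε.1 θ a b).ne'
    · filter_upwards [hpos] with ε hε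
      refine Eventually.of_forall fun θ => ?_
      have hr := norm_regInteraction_le hκ hε.1 hε.2 θ
      rw [hFeq]
      refine (norm_add_le _ _).trans (add_le_add ?_ ?_)
      · rw [norm_mul]
        gcongr
      · rw [norm_mul]
        gcongr
        refine (norm_sum_le _ _).trans (Finset.sum_le_sum fun a _ =>
          (norm_sum_le _ _).trans (Finset.sum_le_sum fun b _ => ?_))
        rw [norm_mul, norm_mul]
        gcongr
        calc _ ≤ C * 1 := mul_le_mul hr (hratio hε.1 θ a b) (norm_nonneg _) (Real.exp_pos _).le
          _ = C := mul_one C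
    · refine (hQi.norm.const_mul C).add (Integrable.const_mul ?_ _)
      exact integrable_finsetSum _ fun a _ => integrable_finsetSum _ fun b _ =>
        (hRi a b).norm.const_mul C
    · refine Eventually.of_forall fun θ => ?_
      simp only [hFeq]
      have h : weightProd V θ * interaction κ θ *
          (Q θ + κ * ∑ a, ∑ b ∈ Finset.Ioi a, R a b θ) =
          interaction κ θ * (weightProd V θ * Q θ) + κ * ∑ a, ∑ b ∈ Finset.Ioi a,
            interaction κ θ * (weightProd V θ * R a b θ) := by
        simp only [mul_add, Finset.mul_sum]
        congr 1
        · ring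
        · refine Finset.sum_congr rfl fun a _ => Finset.sum_congr rfl fun b _ => ?_
          ring
      rw [h]
      refine ((tendsto_regInteraction hκ θ).mul_const _).add (Tendsto.const_mul _ ?_)
      exact tendsto_finsetSum _ fun a _ => tendsto_finsetSum _ fun b hb =>
        (tendsto_regInteraction_mul hκ θ a b (Finset.mem_Ioi.mp hb)).mul_const _
  refine tendsto_nhds_unique hlim (tendsto_const_nhds.congr' ?_)
  filter_upwards [hpos] with ε hε
  exact (integral_divergence_reg hV hint κ hε.1 hGc hGc' hG hper hR).symm

/-! ### Averages and linear statistics -/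

/-- The configuration on the circle with given angles. -/
def circlePt {N : ℕ} (θ : Fin N → ℝ) (j : Fin N) : ℂ := pt (θ j)

theorem circlePt_apply {N : ℕ} (θ : Fin N → ℝ) (j : Fin N) : circlePt θ j = pt (θ j) := rfl

@[fun_prop]
theorem continuous_circlePt {N : ℕ} (j : Fin N) :
    Continuous fun θ : Fin N → ℝ => circlePt θ j := by
  unfold circlePt
  fun_prop

theorem circlePt_sub_ne_zero {N : ℕ} (θ : Fin N → ℝ) (j : Fin N) {z : ℂ} (hz : ‖z‖ ≠ 1) :
    circlePt θ j - z ≠ 0 := sub_ne_zero_of_norm (norm_pt _) hz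

theorem circlePt_ne_zero {N : ℕ} (θ : Fin N → ℝ) (j : Fin N) : circlePt θ j ≠ 0 := pt_ne_zero _

theorem gibbsIntegral_eq (V : ℂ → ℂ) (κ : ℂ) (N : ℕ) (X : (Fin N → ℂ) → ℂ) :
    gibbsIntegral V κ N X = (((2 * Real.pi)⁻¹ : ℝ) : ℂ) ^ N *
      ∫ θ, X (circlePt θ) * density V κ (circlePt θ) ∂torusMeasure N := by
  rw [gibbsIntegral, torusMeasure_eq_restrict]
  rfl

/-- A statistic whose average is an absolutely convergent integral. -/
def Averageable (V : ℂ → ℂ) (κ : ℂ) (N : ℕ) (X : (Fin N → ℂ) → ℂ) : Prop :=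
  Integrable (fun θ => X (circlePt θ) * density V κ (circlePt θ)) (torusMeasure N)

theorem average_one {V : ℂ → ℂ} {κ : ℂ} {N : ℕ} (hZ : partitionZ V κ N ≠ 0) :
    average V κ N (fun _ => 1) = 1 := div_self hZ

theorem average_congr (V : ℂ → ℂ) (κ : ℂ) {N : ℕ} {X Y : (Fin N → ℂ) → ℂ}
    (h : ∀ θ : Fin N → ℝ, X (circlePt θ) = Y (circlePt θ)) :
    average V κ N X = average V κ N Y := by
  simp only [average, gibbsIntegral_eq, h]

theorem average_add {V : ℂ → ℂ} {κ : ℂ} {N : ℕ} {X Y : (Fin N → ℂ) → ℂ}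
    (hX : Averageable V κ N X) (hY : Averageable V κ N Y) :
    average V κ N (fun ζ => X ζ + Y ζ) = average V κ N X + average V κ N Y := by
  simp only [average, gibbsIntegral_eq, add_mul]
  rw [integral_add hX hY]
  ring

theorem average_const_mul (V : ℂ → ℂ) (κ : ℂ) {N : ℕ} (c : ℂ) (X : (Fin N → ℂ) → ℂ) :
    average V κ N (fun ζ => c * X ζ) = c * average V κ N X := by
  simp only [average, gibbsIntegral_eq, mul_assoc]
  rw [integral_const_mul]
  ring

theorem average_sum {V : ℂ → ℂ} {κ : ℂ} {N : ℕ} {ι : Type*} (s : Finset ι)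
    {X : ι → (Fin N → ℂ) → ℂ} (hX : ∀ i ∈ s, Averageable V κ N (X i)) :
    average V κ N (fun ζ => ∑ i ∈ s, X i ζ) = ∑ i ∈ s, average V κ N (X i) := by
  simp only [average, gibbsIntegral_eq, Finset.sum_mul]
  rw [integral_finsetSum s hX, Finset.mul_sum, Finset.sum_div]

theorem integrable_density {V : ℂ → ℂ} (hV : IsPotential V) {κ : ℂ} (hκ : 0 < κ.re) (N : ℕ) :
    Integrable (fun θ => density V κ (circlePt θ)) (torusMeasure N) := by
  have := integrable_torus_mul_continuous (integrable_weightProd hV N)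
    (continuous_interaction hκ (N := N))
  exact this.congr (Eventually.of_forall fun θ => (density_pt V hκ θ).symm)

theorem Averageable.mul_continuous {V : ℂ → ℂ} {κ : ℂ} {N : ℕ} {X Y : (Fin N → ℂ) → ℂ}
    (hX : Averageable V κ N X) (hY : Continuous fun θ : Fin N → ℝ => Y (circlePt θ)) :
    Averageable V κ N (fun ζ => X ζ * Y ζ) := by
  refine (integrable_torus_mul_continuous hX hY).congr (Eventually.of_forall fun θ => ?_)
  simp only
  ring

theorem averageable_of_continuous {V : ℂ → ℂ} (hV : IsPotential V) {κ : ℂ} (hκ : 0 < κ.re)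
    {N : ℕ} {X : (Fin N → ℂ) → ℂ} (hX : Continuous fun θ : Fin N → ℝ => X (circlePt θ)) :
    Averageable V κ N X := by
  refine (integrable_torus_mul_continuous (integrable_density hV hκ N) hX).congr
    (Eventually.of_forall fun θ => ?_)
  simp only
  ring

theorem Averageable.add {V : ℂ → ℂ} {κ : ℂ} {N : ℕ} {X Y : (Fin N → ℂ) → ℂ}
    (hX : Averageable V κ N X) (hY : Averageable V κ N Y) :
    Averageable V κ N (fun ζ => X ζ + Y ζ) := by
  refine (Integrable.add hX hY).congr (Eventually.of_forall fun θ => ?_)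
  simp only [Pi.add_apply]
  ring

theorem Averageable.const_mul {V : ℂ → ℂ} {κ : ℂ} {N : ℕ} {X : (Fin N → ℂ) → ℂ}
    (hX : Averageable V κ N X) (c : ℂ) : Averageable V κ N (fun ζ => c * X ζ) := by
  refine (Integrable.const_mul hX c).congr (Eventually.of_forall fun θ => ?_)
  simp only
  ring

/-- The derivative in `z` of the statistic `A(z)`. -/
def resolventDerivStat (N : ℕ) (z : ℂ) (ζ : Fin N → ℂ) : ℂ := ∑ j, 2 * ζ j / (ζ j - z) ^ 2

/-- The statistic `∑ 1 / ζ_j`. -/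
def invStat (N : ℕ) (ζ : Fin N → ℂ) : ℂ := ∑ j, (ζ j)⁻¹

/-- The derivative of the statistic `A(z₁)` along the vector field `(ζ + z) / (ζ - z) ∂_ζ`. -/
def transportStat (N : ℕ) (z z₁ : ℂ) (ζ : Fin N → ℂ) : ℂ :=
  ∑ j, kernel (ζ j) z * (-2 * z₁ / (ζ j - z₁) ^ 2)

/-- The divergence of the vector field `(ζ + z) / (ζ - z) ∂_ζ` with respect to the density. -/
def divergenceStat (V : ℂ → ℂ) (κ : ℂ) (N : ℕ) (z : ℂ) (ζ : Fin N → ℂ) : ℂ :=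
  (κ - 1) * resolventDerivStat N z ζ +
    (-(κ / (2 * z)) * (resolventStat N z ζ * resolventStat N z ζ) +
      (κ * N ^ 2 / (2 * z) * 1 +
        ((κ * (N - 1) + 1) * invStat N ζ +
          (-1 * potentialStat V N z ζ + -deriv V z * resolventStat N z ζ))))

theorem continuous_resolventStat {N : ℕ} {z : ℂ} (hz : ‖z‖ ≠ 1) :
    Continuous fun θ : Fin N → ℝ => resolventStat N z (circlePt θ) := by
  unfold resolventStat kernel
  exact continuous_finsetSum _ fun j _ => Continuous.div (by fun_prop) (by fun_prop)
    fun θ => circlePt_sub_ne_zero θ j hz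

theorem continuous_resolventDerivStat {N : ℕ} {z : ℂ} (hz : ‖z‖ ≠ 1) :
    Continuous fun θ : Fin N → ℝ => resolventDerivStat N z (circlePt θ) := by
  unfold resolventDerivStat
  exact continuous_finsetSum _ fun j _ => Continuous.div (by fun_prop) (by fun_prop)
    fun θ => pow_ne_zero 2 (circlePt_sub_ne_zero θ j hz)

theorem continuous_invStat {N : ℕ} :
    Continuous fun θ : Fin N → ℝ => invStat N (circlePt θ) := by
  unfold invStat
  exact continuous_finsetSum _ fun j _ => Continuous.inv₀ (by fun_prop)
    fun θ => circlePt_ne_zero θ j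

theorem continuous_transportStat {N : ℕ} {z z₁ : ℂ} (hz : ‖z‖ ≠ 1) (hz₁ : ‖z₁‖ ≠ 1) :
    Continuous fun θ : Fin N → ℝ => transportStat N z z₁ (circlePt θ) := by
  unfold transportStat kernel
  exact continuous_finsetSum _ fun j _ => (Continuous.div (by fun_prop) (by fun_prop)
    fun θ => circlePt_sub_ne_zero θ j hz).mul (Continuous.div (by fun_prop) (by fun_prop)
    fun θ => pow_ne_zero 2 (circlePt_sub_ne_zero θ j hz₁))

theorem continuous_prod_resolventStat {N : ℕ} {ι : Type*} {I : ι → ℂ} (hI : ∀ i, ‖I i‖ ≠ 1)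
    (T : Finset ι) :
    Continuous fun θ : Fin N → ℝ => ∏ i ∈ T, resolventStat N (I i) (circlePt θ) :=
  continuous_finsetProd _ fun i _ => continuous_resolventStat (hI i)

theorem averageable_potentialStat {V : ℂ → ℂ} (hV : IsPotential V) {κ : ℂ} (hκ : 0 < κ.re)
    (N : ℕ) {z : ℂ} (hz : ‖z‖ ≠ 1) (hd : DifferentiableAt ℂ V z) :
    Averageable V κ N (potentialStat V N z) := by
  have hk : ∀ j, Continuous fun θ : Fin N → ℝ => kernel (circlePt θ j) z := fun j => by
    unfold kernel
    exact Continuous.div (by fun_prop) (by fun_prop) fun θ => circlePt_sub_ne_zero θ j hz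
  have h : ∀ j : Fin N, Integrable (fun θ => (weightProd V θ * deriv V (pt (θ j))) *
      (kernel (circlePt θ j) z * interaction κ θ) -
      weightProd V θ * (kernel (circlePt θ j) z * interaction κ θ * deriv V z))
      (torusMeasure N) := fun j =>
    (integrable_torus_mul_continuous (integrable_weightProd_mul_deriv hV
      (integrable_weightDeriv hV hz hd) j) ((hk j).mul (continuous_interaction hκ))).sub
    (integrable_torus_mul_continuous (integrable_weightProd hV N)
      (((hk j).mul (continuous_interaction hκ)).mul continuous_const))
  refine (integrable_finsetSum Finset.univ fun j _ => h j).congr (Eventually.of_forall fun θ => ?_)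
  have hden : density V κ (circlePt θ) = weightProd V θ * interaction κ θ := density_pt V hκ θ
  simp only [hden, potentialStat, Finset.sum_mul]
  refine Finset.sum_congr rfl fun j _ => ?_
  rw [circlePt_apply]
  ring

theorem sum_sum_Ioi_of_symm {N : ℕ} (f : Fin N → Fin N → ℂ) (hf : ∀ a b, f a b = f b a) :
    ∑ a, ∑ b ∈ Finset.Ioi a, f a b = (∑ a, ∑ b, f a b - ∑ a, f a a) / 2 := by
  have h := Finset.sum_sum_Ioi_add_eq_sum_sum_off_diag f
  have h1 : ∀ a, ∑ b ∈ ({a}ᶜ : Finset (Fin N)), f b a = ∑ b, f a b - f a a := by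
    intro a
    rw [eq_sub_iff_add_eq, add_comm, ← Fintype.sum_eq_add_sum_compl a fun b => f b a]
    exact Finset.sum_congr rfl fun b _ => hf b a
  have h2 : ∀ a b, f b a + f a b = 2 * f a b := fun a b => by rw [hf b a]; ring
  simp only [h1, h2, ← Finset.mul_sum, Finset.sum_sub_distrib] at h
  rw [← h]
  ring

/-- The pair sums produced by the interaction, expressed through linear statistics. -/
theorem pair_sum_eq {N : ℕ} {z : ℂ} (hz0 : z ≠ 0) {ζ : Fin N → ℂ} (h0 : ∀ j, ζ j ≠ 0)
    (hz : ∀ j, ζ j - z ≠ 0) :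
    ∑ a, ∑ b ∈ Finset.Ioi a,
        (ζ a + ζ b) * ((ζ a)⁻¹ * (ζ b)⁻¹ - 2 / ((ζ a - z) * (ζ b - z))) =
      (N - 1) * invStat N ζ - resolventStat N z ζ * resolventStat N z ζ / (2 * z)
        + N ^ 2 / (2 * z) + resolventDerivStat N z ζ := by
  have h1 : ∀ a b, (ζ a + ζ b) * ((ζ a)⁻¹ * (ζ b)⁻¹ - 2 / ((ζ a - z) * (ζ b - z))) =
      (ζ a)⁻¹ + (ζ b)⁻¹ - z⁻¹ * (kernel (ζ a) z * kernel (ζ b) z - 1) := by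
    intro a b
    have := h0 a; have := h0 b; have := hz a; have := hz b
    unfold kernel
    field_simp
    ring
  have h2 : ∀ a, (ζ a)⁻¹ + (ζ a)⁻¹ - z⁻¹ * (kernel (ζ a) z * kernel (ζ a) z - 1) =
      2 * (ζ a)⁻¹ - 2 * (2 * ζ a / (ζ a - z) ^ 2) := by
    intro a
    have := h0 a; have := hz a
    unfold kernel
    field_simp
    ring
  simp only [h1]
  rw [sum_sum_Ioi_of_symm _ fun a b => by ring]
  simp only [h2, Finset.sum_sub_distrib, Finset.sum_add_distrib, ← Finset.mul_sum,
    ← Finset.sum_mul, Finset.sum_const, Finset.card_univ, Fintype.card_fin, nsmul_eq_mul, mul_one]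
  simp only [invStat, resolventStat, resolventDerivStat]
  field_simp
  ring

/-! ### The loop equation for moments -/

theorem hasDerivAt_kernel_left {ζ z : ℂ} (h : ζ - z ≠ 0) :
    HasDerivAt (fun x => kernel x z) (-2 * z / (ζ - z) ^ 2) ζ := by
  have h1 := ((hasDerivAt_id' ζ).add_const z).div ((hasDerivAt_id' ζ).sub_const z) h
  refine h1.congr_deriv ?_
  field_simp
  ring

theorem hasDerivAt_kernel_right {ζ z : ℂ} (h : ζ - z ≠ 0) :
    HasDerivAt (fun x => kernel ζ x) (2 * ζ / (ζ - z) ^ 2) z := by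
  have h1 := ((hasDerivAt_id' z).const_add ζ).div ((hasDerivAt_id' z).const_sub ζ) h
  refine h1.congr_deriv ?_
  field_simp
  ring

theorem hasDerivAt_comp_pt {f : ℂ → ℂ} {f' : ℂ} {x : ℝ} (hf : HasDerivAt f f' (pt x)) :
    HasDerivAt (fun t => f (pt t)) (Complex.I * (pt x * f')) x := by
  refine (hf.comp x (hasDerivAt_pt x)).congr_deriv ?_
  ring

theorem hasDerivAt_resolventStat_update {N : ℕ} {z : ℂ} (hz : ‖z‖ ≠ 1) (θ : Fin N → ℝ)
    (j : Fin N) :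
    HasDerivAt (fun x => resolventStat N z (circlePt (Function.update θ j x)))
      (Complex.I * (circlePt θ j * (-2 * z / (circlePt θ j - z) ^ 2))) (θ j) := by
  have h : ∀ l ∈ Finset.univ, HasDerivAt
      (fun x => kernel (circlePt (Function.update θ j x) l) z)
      (if l = j then Complex.I * (circlePt θ j * (-2 * z / (circlePt θ j - z) ^ 2)) else 0)
      (θ j) := by
    intro l _
    by_cases hl : l = j
    · subst hl
      simpa [circlePt] using
        hasDerivAt_comp_pt (hasDerivAt_kernel_left (circlePt_sub_ne_zero θ l hz))
    · simpa [circlePt, hl] using hasDerivAt_const (θ j) (kernel (pt (θ l)) z)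
  have h' := HasDerivAt.fun_sum h
  rw [Finset.sum_ite_eq' Finset.univ j, if_pos (Finset.mem_univ j)] at h'
  exact h'

/-- The loop equation for moments: the average of the total divergence of the vector field
`(ζ + z) / (ζ - z) ∂_ζ`, tested against a product of resolvent statistics, vanishes. -/
theorem moment_loop {V : ℂ → ℂ} (hV : IsPotential V) {κ : ℂ} (hκ : 0 < κ.re) (N : ℕ) {z : ℂ}
    (hz0 : z ≠ 0) (hz : ‖z‖ ≠ 1) (hd : DifferentiableAt ℂ V z) {ι : Type*} [DecidableEq ι]
    {I : ι → ℂ} (hI : ∀ i, ‖I i‖ ≠ 1) (T : Finset ι) :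
    average V κ N (fun ζ => divergenceStat V κ N z ζ * ∏ i ∈ T, resolventStat N (I i) ζ +
      ∑ i ∈ T, transportStat N z (I i) ζ * ∏ l ∈ T.erase i, resolventStat N (I l) ζ) = 0 := by
  set Φ : Finset ι → (Fin N → ℝ) → ℂ := fun T θ => ∏ i ∈ T, resolventStat N (I i) (circlePt θ)
    with hΦ
  have hΦc : ∀ T, Continuous (Φ T) := fun T => continuous_prod_resolventStat hI T
  have hsub : ∀ (θ : Fin N → ℝ) j, circlePt θ j - z ≠ 0 := fun θ j => circlePt_sub_ne_zero θ j hz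
  -- In the angle, the field `(ζ + z) / (ζ - z) ∂_ζ` has component `g ζ`, up to the factor `-i`.
  set g : ℂ → ℂ := fun ζ => kernel ζ z * ζ⁻¹ with hg
  set g' : ℂ → ℂ := fun ζ => -2 * z / (ζ - z) ^ 2 * ζ⁻¹ + kernel ζ z * (-(ζ ^ 2)⁻¹) with hg'
  set G : Fin N → (Fin N → ℝ) → ℂ := fun j θ => g (circlePt θ j) * Φ T θ with hG
  set G' : Fin N → (Fin N → ℝ) → ℂ := fun j θ =>
    Complex.I * (circlePt θ j * g' (circlePt θ j)) * Φ T θ + g (circlePt θ j) *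
      ∑ i ∈ T, Φ (T.erase i) θ *
        (Complex.I * (circlePt θ j * (-2 * I i / (circlePt θ j - I i) ^ 2))) with hG'
  set R : Fin N → Fin N → (Fin N → ℝ) → ℂ := fun a b θ => Complex.I *
    ((circlePt θ a + circlePt θ b) * ((circlePt θ a)⁻¹ * (circlePt θ b)⁻¹ -
      2 / ((circlePt θ a - z) * (circlePt θ b - z)))) * Φ T θ with hR
  have hinv : ∀ j, Continuous fun θ : Fin N → ℝ => (circlePt θ j)⁻¹ := fun j =>
    Continuous.inv₀ (by fun_prop) fun θ => circlePt_ne_zero θ j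
  have hk : ∀ j, Continuous fun θ : Fin N → ℝ => kernel (circlePt θ j) z := fun j => by
    unfold kernel
    exact Continuous.div (by fun_prop) (by fun_prop) fun θ => hsub θ j
  have hgc : ∀ j, Continuous fun θ : Fin N → ℝ => g (circlePt θ j) := fun j =>
    (hk j).mul (hinv j)
  have hgc' : ∀ j, Continuous fun θ : Fin N → ℝ => g' (circlePt θ j) := fun j => by
    refine ((Continuous.div (by fun_prop) (by fun_prop)
      fun θ => pow_ne_zero 2 (hsub θ j)).mul (hinv j)).add ((hk j).mul (Continuous.neg ?_))
    exact Continuous.inv₀ (by fun_prop) fun θ => pow_ne_zero 2 (circlePt_ne_zero θ j)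
  have hGc : ∀ j, Continuous (G j) := fun j => (hgc j).mul (hΦc T)
  have hGc' : ∀ j, Continuous (G' j) := fun j => by
    refine Continuous.add ((continuous_const.mul ((continuous_circlePt j).mul (hgc' j))).mul
      (hΦc T)) ((hgc j).mul (continuous_finsetSum _ fun i _ => (hΦc _).mul
        (continuous_const.mul ((continuous_circlePt j).mul ?_))))
    exact Continuous.div (by fun_prop) (by fun_prop)
      fun θ => pow_ne_zero 2 (circlePt_sub_ne_zero θ j (hI i))
  have hRc : ∀ a b, Continuous (R a b) := fun a b => by
    refine (continuous_const.mul (Continuous.mul (by fun_prop)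
      (((hinv a).mul (hinv b)).sub ?_))).mul (hΦc T)
    exact Continuous.div (by fun_prop) (by fun_prop)
      fun θ => mul_ne_zero (hsub θ a) (hsub θ b)
  have hderiv : ∀ j θ, HasDerivAt (fun x => G j (Function.update θ j x)) (G' j θ) (θ j) := by
    intro j θ
    have h1 : HasDerivAt g (g' (pt (θ j))) (pt (θ j)) :=
      (hasDerivAt_kernel_left (hsub θ j)).mul
        (hasDerivAt_inv (pt_ne_zero _))
    have h2 : HasDerivAt (fun x => g (circlePt (Function.update θ j x) j))
        (Complex.I * (circlePt θ j * g' (circlePt θ j))) (θ j) := by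
      simpa [circlePt] using hasDerivAt_comp_pt h1
    have h3 := HasDerivAt.fun_finsetProd (u := T)
      fun i _ => hasDerivAt_resolventStat_update (hI i) θ j
    have h4 := h2.mul h3
    simp only [Function.update_eq_self, smul_eq_mul] at h4
    exact h4
  have hcirc : ∀ (θ : Fin N → ℝ) j, circlePt (Function.update θ j 0) =
      circlePt (Function.update θ j (2 * Real.pi)) := fun θ j =>
    funext fun i => pt_update_period θ j i
  have hper : ∀ j θ, G j (Function.update θ j 0) = G j (Function.update θ j (2 * Real.pi)) := by
    intro j θ
    simp only [hG, hΦ, hcirc θ j]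
  have hrel : ∀ a b θ, (G a θ - G b θ) * ((2 * Real.sin (θ a - θ b) : ℝ) : ℂ) =
      gap θ a b * R a b θ := by
    intro a b θ
    have ha := circlePt_ne_zero θ a
    have hb := circlePt_ne_zero θ b
    have ha' := hsub θ a
    have hb' := hsub θ b
    rw [ofReal_two_sin, ofReal_gap]
    simp only [hG, hR, hg, kernel, ← circlePt_apply]
    field_simp
    ring
  have hmain := integral_divergence hV (integrable_weightDeriv hV hz hd) hκ hGc hGc' hRc hderiv
    hper hrel
  have hpt : ∀ θ : Fin N → ℝ,
      ∑ j, (G' j θ - Complex.I * pt (θ j) * deriv V (pt (θ j)) * G j θ) +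
        κ * ∑ a, ∑ b ∈ Finset.Ioi a, R a b θ =
      Complex.I * (divergenceStat V κ N z (circlePt θ) * Φ T θ +
        ∑ i ∈ T, transportStat N z (I i) (circlePt θ) * Φ (T.erase i) θ) := by
    intro θ
    have h0 := circlePt_ne_zero θ
    have e1 : ∑ a, ∑ b ∈ Finset.Ioi a, R a b θ = Complex.I *
        ((N - 1) * invStat N (circlePt θ) -
          resolventStat N z (circlePt θ) * resolventStat N z (circlePt θ) / (2 * z)
          + N ^ 2 / (2 * z) + resolventDerivStat N z (circlePt θ)) * Φ T θ := by
      rw [← pair_sum_eq hz0 h0 (hsub θ)]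
      simp only [hR, Finset.mul_sum, Finset.sum_mul]
    have e2 : ∑ i ∈ T, transportStat N z (I i) (circlePt θ) * Φ (T.erase i) θ =
        ∑ j, kernel (circlePt θ j) z *
          ∑ i ∈ T, Φ (T.erase i) θ * (-2 * I i / (circlePt θ j - I i) ^ 2) := by
      simp only [transportStat, Finset.mul_sum, Finset.sum_mul]
      rw [Finset.sum_comm]
      refine Finset.sum_congr rfl fun j _ => Finset.sum_congr rfl fun i _ => ?_
      ring
    have e3 : potentialStat V N z (circlePt θ) + deriv V z * resolventStat N z (circlePt θ) =
        ∑ j, kernel (circlePt θ j) z * deriv V (circlePt θ j) := by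
      simp only [potentialStat, resolventStat, Finset.mul_sum]
      rw [← Finset.sum_add_distrib]
      refine Finset.sum_congr rfl fun j _ => ?_
      ring
    have e4 : ∑ j, circlePt θ j * g' (circlePt θ j) =
        invStat N (circlePt θ) - resolventDerivStat N z (circlePt θ) := by
      simp only [invStat, resolventDerivStat]
      rw [← Finset.sum_sub_distrib]
      refine Finset.sum_congr rfl fun j _ => ?_
      have := h0 j
      have := hsub θ j
      simp only [hg', kernel]
      field_simp
      ring
    have e5 : ∑ j, (G' j θ - Complex.I * pt (θ j) * deriv V (pt (θ j)) * G j θ) =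
        Complex.I * ((∑ j, circlePt θ j * g' (circlePt θ j)) * Φ T θ +
          ∑ j, kernel (circlePt θ j) z *
            ∑ i ∈ T, Φ (T.erase i) θ * (-2 * I i / (circlePt θ j - I i) ^ 2) -
          (∑ j, kernel (circlePt θ j) z * deriv V (circlePt θ j)) * Φ T θ) := by
      rw [Finset.sum_mul, Finset.sum_mul, ← Finset.sum_add_distrib, ← Finset.sum_sub_distrib,
        Finset.mul_sum]
      refine Finset.sum_congr rfl fun j _ => ?_
      have hj := h0 j
      have e6 : ∑ i ∈ T, Φ (T.erase i) θ *
          (Complex.I * (circlePt θ j * (-2 * I i / (circlePt θ j - I i) ^ 2))) =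
          Complex.I * circlePt θ j *
            ∑ i ∈ T, Φ (T.erase i) θ * (-2 * I i / (circlePt θ j - I i) ^ 2) := by
        rw [Finset.mul_sum]
        refine Finset.sum_congr rfl fun i _ => ?_
        ring
      have hj' : circlePt θ j * (circlePt θ j)⁻¹ = 1 := mul_inv_cancel₀ hj
      simp only [hG', hG, e6, hg, ← circlePt_apply]
      generalize ∑ i ∈ T, Φ (T.erase i) θ * (-2 * I i / (circlePt θ j - I i) ^ 2) = σ
      linear_combination (Complex.I * kernel (circlePt θ j) z *
        (σ - deriv V (circlePt θ j) * Φ T θ)) * hj'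
    rw [e5, e1, e2, e4, ← e3, divergenceStat]
    ring
  have hden : ∀ θ : Fin N → ℝ, density V κ (circlePt θ) = weightProd V θ * interaction κ θ :=
    fun θ => density_pt V hκ θ
  rw [average, gibbsIntegral_eq]
  have hI0 : Complex.I * ∫ θ, (divergenceStat V κ N z (circlePt θ) * Φ T θ +
        ∑ i ∈ T, transportStat N z (I i) (circlePt θ) * Φ (T.erase i) θ) *
          density V κ (circlePt θ) ∂torusMeasure N = 0 := by
    rw [← integral_const_mul, ← hmain]
    refine integral_congr_ae (Eventually.of_forall fun θ => ?_)
    simp only [hpt, hden]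
    ring
  rw [(mul_eq_zero.mp hI0).resolve_left Complex.I_ne_zero, mul_zero, zero_div]

/-! ### Cumulants with resolvent statistics -/

/-- The average may be differentiated in `z`: near `z` the parameter stays at a distance at least `δ`
from the circle, so the derivative of the integrand is dominated by a multiple of the density. -/
theorem hasDerivAt_average_resolventStat_mul {V : ℂ → ℂ} (hV : IsPotential V) {κ : ℂ}
    (hκ : 0 < κ.re) {N : ℕ} {z : ℂ} (hz : ‖z‖ ≠ 1) {Y : (Fin N → ℂ) → ℂ}
    (hY : Continuous fun θ : Fin N → ℝ => Y (circlePt θ)) :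
    HasDerivAt (fun u => average V κ N (fun ζ => resolventStat N u ζ * Y ζ))
      (average V κ N (fun ζ => resolventDerivStat N z ζ * Y ζ)) z := by
  set δ : ℝ := |1 - ‖z‖| / 2 with hδ
  have hδ0 : 0 < δ := half_pos (abs_pos.mpr (sub_ne_zero.mpr (Ne.symm hz)))
  have hfar : ∀ u ∈ Metric.ball z δ, ∀ (θ : Fin N → ℝ) j, δ ≤ ‖circlePt θ j - u‖ := by
    intro u hu θ j
    rw [Metric.mem_ball, dist_eq_norm] at hu
    have h1 : |1 - ‖z‖| ≤ ‖circlePt θ j - z‖ := by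
      have := abs_norm_sub_norm_le (circlePt θ j) z
      rwa [circlePt, norm_pt] at this
    have h2 : ‖circlePt θ j - z‖ ≤ ‖circlePt θ j - u‖ + ‖u - z‖ := by
      simpa using norm_add_le (circlePt θ j - u) (u - z)
    linarith
  have hne : ∀ u ∈ Metric.ball z δ, ‖u‖ ≠ 1 := by
    intro u hu h
    rw [Metric.mem_ball, dist_eq_norm] at hu
    have := abs_norm_sub_norm_le u z
    rw [h] at this
    linarith
  have hYi : Integrable (fun θ => Y (circlePt θ) * density V κ (circlePt θ)) (torusMeasure N) :=
    averageable_of_continuous hV hκ hY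
  have hmeas : ∀ u, ‖u‖ ≠ 1 → Integrable
      (fun θ => resolventStat N u (circlePt θ) * Y (circlePt θ) * density V κ (circlePt θ))
      (torusMeasure N) := fun u hu =>
    averageable_of_continuous (X := fun ζ => resolventStat N u ζ * Y ζ) hV hκ
      ((continuous_resolventStat hu).mul hY)
  have hmain := hasDerivAt_integral_of_dominated_loc_of_deriv_le
    (F := fun u θ => resolventStat N u (circlePt θ) * Y (circlePt θ) * density V κ (circlePt θ))
    (F' := fun u θ => resolventDerivStat N u (circlePt θ) * Y (circlePt θ) *
      density V κ (circlePt θ))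
    (bound := fun θ => N * (2 / δ ^ 2) * ‖Y (circlePt θ) * density V κ (circlePt θ)‖)
    (μ := torusMeasure N) (Metric.ball_mem_nhds z hδ0)
    (by
      filter_upwards [Metric.ball_mem_nhds z hδ0] with u hu
      exact (hmeas u (hne u hu)).1)
    (hmeas z hz)
    (averageable_of_continuous (X := fun ζ => resolventDerivStat N z ζ * Y ζ) hV hκ
      ((continuous_resolventDerivStat hz).mul hY)).1
    (by
      refine Eventually.of_forall fun θ u hu => ?_
      rw [mul_assoc, norm_mul]
      gcongr
      have hterm : ∀ j ∈ Finset.univ, ‖2 * circlePt θ j / (circlePt θ j - u) ^ 2‖ ≤ 2 / δ ^ 2 := by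
        intro j _
        rw [norm_div, norm_mul, norm_pow, circlePt_apply, norm_pt, ← circlePt_apply]
        have := hfar u hu θ j
        simp only [Complex.norm_ofNat, mul_one]
        gcongr
      refine (norm_sum_le_of_le _ hterm).trans ?_
      simp)
    (hYi.norm.const_mul _)
    (by
      refine Eventually.of_forall fun θ u hu => ?_
      have h : HasDerivAt (fun u => resolventStat N u (circlePt θ))
          (resolventDerivStat N u (circlePt θ)) u := by
        unfold resolventStat resolventDerivStat
        exact HasDerivAt.fun_sum fun j _ =>
          hasDerivAt_kernel_right (circlePt_sub_ne_zero θ j (hne u hu))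
      exact (h.mul_const _).mul_const _)
  simp only [average, gibbsIntegral_eq]
  exact (hmain.2.const_mul _).div_const _

/-- The cumulant `⟨X ∏_{i ∈ T} A(z_i)⟩_c` of a statistic `X` with resolvent statistics. -/
def connected (V : ℂ → ℂ) (κ : ℂ) (N : ℕ) {ι : Type*} [DecidableEq ι] (I : ι → ℂ)
    (X : (Fin N → ℂ) → ℂ) (T : Finset ι) : ℂ :=
  adjoinCumulant (average V κ N) (fun i => resolventStat N (I i)) X T

section Connected

variable {V : ℂ → ℂ} {κ : ℂ} {N : ℕ} {ι : Type*} [DecidableEq ι] {I : ι → ℂ}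

/-- The cumulants with `X` are a combination, with coefficients independent of `X`, of the mixed
moments with `X`. -/
theorem connected_eq (hZ : partitionZ V κ N ≠ 0) (I : ι → ℂ) :
    ∃ c : Finset ι → ℂ, ∀ X, connected V κ N I X = subsetConv
      (fun J => average V κ N (fun ζ => X ζ * ∏ i ∈ J, resolventStat N (I i) ζ)) c :=
  ⟨_, fun X => adjoinCumulant_eq_conv _ (average_one hZ) _ X⟩

theorem connected_congr (hZ : partitionZ V κ N ≠ 0) {X Y : (Fin N → ℂ) → ℂ}
    (h : ∀ θ : Fin N → ℝ, X (circlePt θ) = Y (circlePt θ)) :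
    connected V κ N I X = connected V κ N I Y := by
  obtain ⟨c, hc⟩ := connected_eq hZ I
  rw [hc, hc]
  congr 1
  funext J
  exact average_congr V κ fun θ => by rw [h]

theorem connected_add (hZ : partitionZ V κ N ≠ 0) (hI : ∀ i, ‖I i‖ ≠ 1)
    {X Y : (Fin N → ℂ) → ℂ} (hX : Averageable V κ N X) (hY : Averageable V κ N Y)
    (T : Finset ι) :
    connected V κ N I (fun ζ => X ζ + Y ζ) T = connected V κ N I X T + connected V κ N I Y T := by
  obtain ⟨c, hc⟩ := connected_eq hZ I
  simp only [hc, subsetConv]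
  rw [← Finset.sum_add_distrib]
  refine Finset.sum_congr rfl fun J _ => ?_
  have hΦ := continuous_prod_resolventStat (N := N) hI J
  rw [← add_mul, ← average_add (hX.mul_continuous hΦ) (hY.mul_continuous hΦ)]
  simp only [add_mul]

theorem connected_const_mul (hZ : partitionZ V κ N ≠ 0) (a : ℂ) (X : (Fin N → ℂ) → ℂ)
    (T : Finset ι) :
    connected V κ N I (fun ζ => a * X ζ) T = a * connected V κ N I X T := by
  obtain ⟨c, hc⟩ := connected_eq hZ I
  simp only [hc, subsetConv, Finset.mul_sum]
  refine Finset.sum_congr rfl fun J _ => ?_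
  simp only [mul_assoc a, average_const_mul]

theorem connected_one (hZ : partitionZ V κ N ≠ 0) (T : Finset ι) :
    connected V κ N I (fun _ => 1) T = if T = ∅ then 1 else 0 :=
  congrFun (adjoinCumulant_one _ (average_one hZ) _) T

theorem hasDerivAt_connected (hV : IsPotential V) (hκ : 0 < κ.re) (hZ : partitionZ V κ N ≠ 0)
    (hI : ∀ i, ‖I i‖ ≠ 1) {z : ℂ} (hz : ‖z‖ ≠ 1) (T : Finset ι) :
    HasDerivAt (fun u => connected V κ N I (resolventStat N u) T)
      (connected V κ N I (resolventDerivStat N z) T) z := by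
  obtain ⟨c, hc⟩ := connected_eq hZ I
  simp only [hc, subsetConv]
  exact HasDerivAt.fun_sum fun J _ => (hasDerivAt_average_resolventStat_mul hV hκ hz
    (continuous_prod_resolventStat hI J)).mul_const _

theorem averageable_divergenceStat (hV : IsPotential V) (hκ : 0 < κ.re) {z : ℂ} (hz : ‖z‖ ≠ 1)
    (hd : DifferentiableAt ℂ V z) : Averageable V κ N (divergenceStat V κ N z) := by
  have hA := continuous_resolventStat (N := N) hz
  refine ((averageable_of_continuous hV hκ (continuous_resolventDerivStat hz)).const_mul _).add
    (((averageable_of_continuous hV hκ (X := fun ζ => resolventStat N z ζ * resolventStat N z ζ)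
      (hA.mul hA)).const_mul _).add
    (((averageable_of_continuous hV hκ continuous_const).const_mul _).add
    (((averageable_of_continuous hV hκ continuous_invStat).const_mul _).add
    (((averageable_potentialStat hV hκ N hz hd).const_mul _).add
    ((averageable_of_continuous hV hκ hA).const_mul _)))))

/-- The loop equation for moments, convolved with the inverse of the moment function, becomes the loop
equation for cumulants. -/
theorem connected_loop (hV : IsPotential V) (hκ : 0 < κ.re) (hZ : partitionZ V κ N ≠ 0)
    {z : ℂ} (hz0 : z ≠ 0) (hz : ‖z‖ ≠ 1) (hd : DifferentiableAt ℂ V z) (hI : ∀ i, ‖I i‖ ≠ 1)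
    (T : Finset ι) :
    connected V κ N I (divergenceStat V κ N z) T +
      ∑ i ∈ T, connected V κ N I (transportStat N z (I i)) (T.erase i) = 0 := by
  obtain ⟨c, hc⟩ := connected_eq hZ I
  simp only [hc]
  rw [← subsetConv_sum_erase (fun i J => average V κ N
    (fun ζ => transportStat N z (I i) ζ * ∏ l ∈ J, resolventStat N (I l) ζ))]
  simp only [subsetConv]
  rw [← Finset.sum_add_distrib]
  refine Finset.sum_eq_zero fun J _ => ?_
  have htr : ∀ i ∈ J, Averageable V κ N
      (fun ζ => transportStat N z (I i) ζ * ∏ l ∈ J.erase i, resolventStat N (I l) ζ) :=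
    fun i _ => averageable_of_continuous hV hκ
      ((continuous_transportStat hz (hI i)).mul (continuous_prod_resolventStat hI _))
  have hsum : Averageable V κ N (fun ζ =>
      ∑ i ∈ J, transportStat N z (I i) ζ * ∏ l ∈ J.erase i, resolventStat N (I l) ζ) :=
    averageable_of_continuous hV hκ (continuous_finsetSum _ fun i _ =>
      ((continuous_transportStat hz (hI i)).mul (continuous_prod_resolventStat hI _)))
  rw [← add_mul, ← average_sum J htr,
    ← average_add ((averageable_divergenceStat hV hκ hz hd).mul_continuous
      (continuous_prod_resolventStat hI J)) hsum,
    moment_loop hV hκ N hz0 hz hd hI J, zero_mul]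

theorem connected_divergenceStat (hV : IsPotential V) (hκ : 0 < κ.re)
    (hZ : partitionZ V κ N ≠ 0) {z : ℂ} (hz : ‖z‖ ≠ 1)
    (hd : DifferentiableAt ℂ V z) (hI : ∀ i, ‖I i‖ ≠ 1) {T : Finset ι} (hT : T.Nonempty) :
    connected V κ N I (divergenceStat V κ N z) T =
      (κ - 1) * connected V κ N I (resolventDerivStat N z) T -
        κ / (2 * z) * (adjoinCumulant (average V κ N)
            (adjoin (resolventStat N z) fun i => resolventStat N (I i)) (resolventStat N z)
            (Finset.insertNone T) +
          ∑ J ∈ T.powerset, connected V κ N I (resolventStat N z) J *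
            connected V κ N I (resolventStat N z) (T \ J)) +
        (κ * (N - 1) + 1) * connected V κ N I (invStat N) T -
        connected V κ N I (potentialStat V N z) T -
        deriv V z * connected V κ N I (resolventStat N z) T := by
  have hA := continuous_resolventStat (N := N) hz
  have a1 := (averageable_of_continuous (V := V) hV hκ hA).const_mul (-deriv V z)
  have a2 := (averageable_potentialStat hV hκ N hz hd).const_mul (-1)
  have a3 := (averageable_of_continuous (V := V) hV hκ (continuous_invStat (N := N))).const_mul
    (κ * (N - 1) + 1)
  have a4 := (averageable_of_continuous (V := V) hV hκ (N := N) (X := fun _ => 1)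
    continuous_const).const_mul (κ * N ^ 2 / (2 * z))
  have a5 := (averageable_of_continuous hV hκ
    (X := fun ζ => resolventStat N z ζ * resolventStat N z ζ) (hA.mul hA)).const_mul
    (-(κ / (2 * z)))
  have a6 := (averageable_of_continuous (V := V) hV hκ
    (continuous_resolventDerivStat (N := N) hz)).const_mul (κ - 1)
  have hmul : connected V κ N I (fun ζ => resolventStat N z ζ * resolventStat N z ζ) T = _ :=
    adjoinCumulant_mul _ (average_one hZ) (fun i => resolventStat N (I i)) (resolventStat N z)
      (resolventStat N z) T
  change connected V κ N I (fun ζ => _ + (_ + (_ + (_ + (_ + _))))) T = _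
  rw [connected_add hZ hI a6 (a5.add (a4.add (a3.add (a2.add a1)))),
    connected_add hZ hI a5 (a4.add (a3.add (a2.add a1))),
    connected_add hZ hI a4 (a3.add (a2.add a1)),
    connected_add hZ hI a3 (a2.add a1), connected_add hZ hI a2 a1]
  simp only [connected_const_mul hZ, hmul, connected_one hZ, hT.ne_empty, if_false]
  simp only [connected]
  ring

/-- Decomposition of the transported statistic that matches the terms of the loop equation; the
coefficient `-2 z / (z₁ - z)²` is the derivative in `z₁` of `(z₁ + z) / (z₁ - z)`. -/
theorem transportStat_eq {z z₁ : ℂ} (hz₁ : z₁ ≠ 0) (hne : z ≠ z₁) {ζ : Fin N → ℂ}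
    (h : ∀ j, ζ j - z ≠ 0) (h₁ : ∀ j, ζ j - z₁ ≠ 0) :
    transportStat N z z₁ ζ =
      (1 / z₁ * kernel z₁ z - -2 * z / (z₁ - z) ^ 2) * resolventStat N z₁ ζ +
      (-(1 / z₁ * kernel z₁ z - -2 * z / (z₁ - z) ^ 2) - 1 / z₁) * resolventStat N z ζ +
      (-kernel z₁ z * resolventDerivStat N z₁ ζ + N / z₁ * 1) := by
  have hN : (N : ℂ) / z₁ * 1 = ∑ _j : Fin N, 1 / z₁ := by
    simp [div_eq_mul_inv]
  rw [hN]
  simp only [transportStat, resolventStat, resolventDerivStat, Finset.mul_sum]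
  rw [← Finset.sum_add_distrib, ← Finset.sum_add_distrib, ← Finset.sum_add_distrib]
  refine Finset.sum_congr rfl fun j _ => ?_
  have hj := h j
  have hj₁ := h₁ j
  have hne' : z₁ - z ≠ 0 := sub_ne_zero.mpr hne.symm
  unfold kernel
  field_simp
  ring

theorem connected_transportStat (hV : IsPotential V) (hκ : 0 < κ.re)
    (hZ : partitionZ V κ N ≠ 0) {z z₁ : ℂ} (hz : ‖z‖ ≠ 1) (hz₁ : ‖z₁‖ ≠ 1) (h0 : z₁ ≠ 0)
    (hne : z ≠ z₁) (hI : ∀ i, ‖I i‖ ≠ 1) (T : Finset ι) :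
    connected V κ N I (transportStat N z z₁) T =
      -(-2 * z / (z₁ - z) ^ 2 * (connected V κ N I (resolventStat N z₁) T -
          connected V κ N I (resolventStat N z) T) +
        kernel z₁ z * connected V κ N I (resolventDerivStat N z₁) T) +
      1 / z₁ * kernel z₁ z * (connected V κ N I (resolventStat N z₁) T -
          connected V κ N I (resolventStat N z) T) -
      1 / z₁ * connected V κ N I (resolventStat N z) T +
      N / z₁ * (if T = ∅ then 1 else 0) := by
  rw [connected_congr hZ (Y := fun ζ =>
      (1 / z₁ * kernel z₁ z - -2 * z / (z₁ - z) ^ 2) * resolventStat N z₁ ζ +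
      (-(1 / z₁ * kernel z₁ z - -2 * z / (z₁ - z) ^ 2) - 1 / z₁) * resolventStat N z ζ +
      (-kernel z₁ z * resolventDerivStat N z₁ ζ + N / z₁ * 1)) fun θ => transportStat_eq h0 hne
    (fun j => circlePt_sub_ne_zero θ j hz) (fun j => circlePt_sub_ne_zero θ j hz₁)]
  have av : ∀ (c : ℂ) {X : (Fin N → ℂ) → ℂ}, (Continuous fun θ : Fin N → ℝ => X (circlePt θ)) →
      Averageable V κ N (fun ζ => c * X ζ) := fun c _ hX =>
    (averageable_of_continuous hV hκ hX).const_mul c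
  have a1 := av (1 / z₁ * kernel z₁ z - -2 * z / (z₁ - z) ^ 2)
    (continuous_resolventStat (N := N) hz₁)
  have a2 := av (-(1 / z₁ * kernel z₁ z - -2 * z / (z₁ - z) ^ 2) - 1 / z₁)
    (continuous_resolventStat (N := N) hz)
  have a3 := av (-kernel z₁ z) (continuous_resolventDerivStat (N := N) hz₁)
  have a4 := av (N / z₁) (X := fun _ => 1) continuous_const
  rw [connected_add hZ hI (a1.add a2) (a3.add a4), connected_add hZ hI a1 a2,
    connected_add hZ hI a3 a4]
  simp only [connected_const_mul hZ, connected_one hZ]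
  ring

theorem connected_resolventStat_zero (hZ : partitionZ V κ N ≠ 0) {T : Finset ι}
    (hT : T.Nonempty) : connected V κ N I (resolventStat N 0) T = 0 := by
  have h : ∀ θ : Fin N → ℝ, resolventStat N 0 (circlePt θ) = N * 1 := by
    intro θ
    simp [resolventStat, kernel, circlePt_ne_zero]
  rw [connected_congr hZ (Y := fun _ => (N : ℂ) * 1) h, connected_const_mul hZ,
    connected_one hZ, if_neg hT.ne_empty, mul_zero]

theorem resolventDerivStat_zero {ζ : Fin N → ℂ} (h : ∀ j, ζ j ≠ 0) :
    resolventDerivStat N 0 ζ = 2 * invStat N ζ := by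
  simp only [resolventDerivStat, invStat, Finset.mul_sum]
  refine Finset.sum_congr rfl fun j _ => ?_
  have := h j
  field_simp
  ring

/-- As `u → 0` the statistic `A(u)` tends to the constant `N`, so the limit of `⟨A(u) ⋯⟩_c / u` is
a derivative at the origin. -/
theorem tendsto_connected_div (hV : IsPotential V) (hκ : 0 < κ.re) (hZ : partitionZ V κ N ≠ 0)
    (hI : ∀ i, ‖I i‖ ≠ 1) {T : Finset ι} (hT : T.Nonempty) :
    Tendsto (fun u => connected V κ N I (resolventStat N u) T / u) (𝓝[≠] 0)
      (𝓝 (2 * connected V κ N I (invStat N) T)) := by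
  have h := hasDerivAt_connected hV hκ hZ hI (z := 0) (by simp) T
  rw [hasDerivAt_iff_tendsto_slope] at h
  rw [connected_congr hZ (Y := fun ζ => 2 * invStat N ζ)
    fun θ => resolventDerivStat_zero (circlePt_ne_zero θ), connected_const_mul hZ] at h
  refine h.congr fun u => ?_
  rw [slope_def_field, connected_resolventStat_zero hZ hT, sub_zero, sub_zero]

end Connected

/-! ### Strings and the loop equations -/

/-- A cumulant of a string, re-indexed by an arbitrary embedding of its positions. -/
theorem jointCumulant_univ_eq {Ω ι' : Type*} [DecidableEq ι'] {E : (Ω → ℂ) → ℂ}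
    (hE : E (fun _ => 1) = 1) {n : ℕ} [NeZero n] (e : Fin n ↪ ι') {A : Fin n → Ω → ℂ}
    {A' : ι' → Ω → ℂ} (hA : ∀ i, A' (e i) = A i) {s : Finset ι'} (hs : Finset.univ.map e = s) :
    jointCumulant E A Finset.univ = jointCumulant E A' s := by
  rw [← hs, jointCumulant_map E hE e A A' hA ⟨0, Finset.mem_univ _⟩]

theorem map_finSuccEquiv_univ (m : ℕ) :
    Finset.univ.map (finSuccEquiv m).toEmbedding = Finset.insertNone Finset.univ := by
  rw [Finset.map_univ_equiv]
  ext (_ | x) <;> simp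

section Strings

variable {V : ℂ → ℂ} {κ : ℂ} {N m : ℕ}

theorem W_vecCons (hZ : partitionZ V κ N ≠ 0) (I : Fin m → ℂ) (u : ℂ) :
    W V κ N (Matrix.vecCons u I) =
    connected V κ N I (resolventStat N u) Finset.univ := by
  refine jointCumulant_univ_eq (average_one hZ) (finSuccEquiv m).toEmbedding (fun i => ?_)
    (map_finSuccEquiv_univ m)
  cases i using Fin.cases <;> simp [adjoin]

theorem P_eq_connected (hZ : partitionZ V κ N ≠ 0) (I : Fin m → ℂ) (z : ℂ) :
    P V κ N z I =
    connected V κ N I (potentialStat V N z) Finset.univ := by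
  refine jointCumulant_univ_eq (average_one hZ) (finSuccEquiv m).toEmbedding (fun i => ?_)
    (map_finSuccEquiv_univ m)
  cases i using Fin.cases <;> simp [adjoin]

theorem W_vecCons_vecCons (hZ : partitionZ V κ N ≠ 0) (I : Fin m → ℂ) (u z : ℂ) :
    W V κ N (Matrix.vecCons u (Matrix.vecCons z I)) =
    adjoinCumulant (average V κ N)
      (adjoin (resolventStat N z) fun i => resolventStat N (I i)) (resolventStat N u)
      (Finset.insertNone Finset.univ) := by
  refine jointCumulant_univ_eq (average_one hZ)
    ((finSuccEquiv (m + 1)).trans (finSuccEquiv m).optionCongr).toEmbedding (fun i => ?_) ?_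
  · cases i using Fin.cases with
    | zero => simp [adjoin]
    | succ i => cases i using Fin.cases <;> rfl
  · rw [Finset.map_univ_equiv]
    ext (_ | _ | x) <;> simp

theorem W_catSub (hZ : partitionZ V κ N ≠ 0) (I : Fin m → ℂ) (u : ℂ) (J : Finset (Fin m)) :
    W V κ N (catSub u I J) =
    connected V κ N I (resolventStat N u) J := by
  refine jointCumulant_univ_eq (average_one hZ)
    ((finSuccEquiv _).toEmbedding.trans (J.orderEmbOfFin rfl).toEmbedding.optionMap)
    (fun i => ?_) ?_
  · cases i using Fin.cases <;> simp [adjoin, catSub]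
  · rw [← Finset.map_map, map_finSuccEquiv_univ]
    ext (_ | x)
    · simp
    · have h : x ∈ J ↔ ∃ a, J.orderEmbOfFin rfl a = x := by
        rw [← Finset.mem_coe, ← Finset.range_orderEmbOfFin J rfl, Set.mem_range]
      simp [h]

/-- Changing the `j`-th entry of `I` to `t` is the same as adjoining `t` to `I` with its `j`-th entry
removed, since cumulants are symmetric. -/
theorem W_update (hZ : partitionZ V κ N ≠ 0) (I : Fin m → ℂ) (j : Fin m) (t : ℂ) :
    W V κ N (Function.update I j t) =
    connected V κ N I (resolventStat N t) {j}ᶜ := by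
  have : NeZero m := ⟨fun h => by subst h; exact j.elim0⟩
  refine jointCumulant_univ_eq (average_one hZ)
    (Function.Embedding.some.trans (Equiv.swap none (some j)).toEmbedding) (fun i => ?_) ?_
  · by_cases h : i = j
    · subst h
      simp [adjoin]
    · have : Equiv.swap none (some j) (some i) = some i :=
        Equiv.swap_apply_of_ne_of_ne (by simp) (by simpa using h)
      simp [adjoin, h, this]
  · ext o
    rw [← Finset.map_map, Finset.mem_map_equiv, Equiv.symm_swap]
    rcases o with _ | x
    · simp
    · by_cases h : x = j
      · subst h
        simp
      · have : Equiv.swap none (some j) (some x) = some x :=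
          Equiv.swap_apply_of_ne_of_ne (by simp) (by simpa using h)
        simp [h, this]

theorem W_singleton (hZ : partitionZ V κ N ≠ 0) (I : Fin m → ℂ) (u : ℂ) :
    W V κ N ![u] = connected V κ N I (resolventStat N u) ∅ := by
  refine jointCumulant_univ_eq (average_one hZ)
    (⟨fun _ => none, fun _ _ _ => Subsingleton.elim _ _⟩ : Fin 1 ↪ Option (Fin m))
    (fun i => ?_) ?_
  · rw [Subsingleton.elim i 0]
    rfl
  · ext (_ | x)
    · exact iff_of_true (Finset.mem_map.mpr ⟨0, Finset.mem_univ _, rfl⟩)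
        Finset.none_mem_insertNone
    · simp

end Strings

/-- The loop equation for a string `I` of any positive length. The last sum comes from the
constant `N`, whose cumulants with a nonempty family vanish: it is present only if `I` has
length one. -/
theorem loop_equation {V : ℂ → ℂ} (hV : IsPotential V) {κ : ℂ} (hκ : 0 < κ.re) {N : ℕ}
    (hZ : partitionZ V κ N ≠ 0) {m : ℕ} (hm : 1 ≤ m) {z : ℂ} {I : Fin m → ℂ} (hz0 : z ≠ 0)
    (hz : ‖z‖ ≠ 1) (hI : ∀ j, I j ≠ 0 ∧ ‖I j‖ ≠ 1 ∧ z ≠ I j) (hd : DifferentiableAt ℂ V z) :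
    ∃ (dW : ℂ) (D : Fin m → ℂ) (L : ℂ),
        HasDerivAt (fun u => W V κ N (Matrix.vecCons u I)) dW z ∧
        (∀ j, HasDerivAt (fun t => kernel t z *
            (W V κ N (Function.update I j t) - W V κ N (catSub z I {j}ᶜ))) (D j) (I j)) ∧
        Tendsto (fun u => W V κ N (Matrix.vecCons u I) / u) (𝓝[≠] 0) (𝓝 L) ∧
        (κ - 1) * dW
          - 1 / 2 * κ * z⁻¹ * (W V κ N (Matrix.vecCons z (Matrix.vecCons z I))
              + ∑ J : Finset (Fin m), W V κ N (catSub z I J) * W V κ N (catSub z I Jᶜ))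
          - P V κ N z I - deriv V z * W V κ N (Matrix.vecCons z I)
          - ∑ j, D j
          + ∑ j, 1 / I j * kernel (I j) z * (W V κ N I - W V κ N (catSub z I {j}ᶜ))
          - ∑ j, 1 / I j * W V κ N (catSub z I {j}ᶜ)
          + ∑ j, N / I j * (if ({j}ᶜ : Finset (Fin m)) = ∅ then 1 else 0)
          + 1 / 2 * (κ * N + 1 - κ) * L = 0 := by
  have hIn : ∀ j, ‖I j‖ ≠ 1 := fun j => (hI j).2.1
  have hne : (Finset.univ : Finset (Fin m)).Nonempty := ⟨⟨0, hm⟩, Finset.mem_univ _⟩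
  have hself : ∀ j, W V κ N I = connected V κ N I (resolventStat N (I j)) {j}ᶜ := fun j => by
    rw [← W_update hZ, Function.update_eq_self]
  refine ⟨connected V κ N I (resolventDerivStat N z) Finset.univ,
    fun j => -2 * z / (I j - z) ^ 2 * (connected V κ N I (resolventStat N (I j)) {j}ᶜ -
          connected V κ N I (resolventStat N z) {j}ᶜ) +
        kernel (I j) z * connected V κ N I (resolventDerivStat N (I j)) {j}ᶜ,
    2 * connected V κ N I (invStat N) Finset.univ, ?_, ?_, ?_, ?_⟩
  · simp only [W_vecCons hZ]
    exact hasDerivAt_connected hV hκ hZ hIn hz _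
  · intro j
    simp only [W_update hZ, W_catSub hZ]
    exact (hasDerivAt_kernel_left (sub_ne_zero.mpr (hI j).2.2.symm)).mul
      ((hasDerivAt_connected hV hκ hZ hIn (hIn j) _).sub_const _)
  · simp only [W_vecCons hZ]
    exact tendsto_connected_div hV hκ hZ hIn hne
  · have h := connected_loop hV hκ hZ hz0 hz hd hIn Finset.univ
    rw [connected_divergenceStat hV hκ hZ hz hd hIn hne] at h
    have hc : ∀ j : Fin m, (Finset.univ : Finset (Fin m)).erase j = {j}ᶜ := fun j => by
      ext x
      simp
    have hW : ∑ j, 1 / I j * kernel (I j) z * (W V κ N I - W V κ N (catSub z I {j}ᶜ)) =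
        ∑ j, 1 / I j * kernel (I j) z * (connected V κ N I (resolventStat N (I j)) {j}ᶜ -
          connected V κ N I (resolventStat N z) {j}ᶜ) :=
      Finset.sum_congr rfl fun j _ => by rw [← hself j, W_catSub hZ]
    simp only [hc, connected_transportStat hV hκ hZ hz (hIn _) (hI _).1 (hI _).2.2 hIn,
      Finset.sum_add_distrib, Finset.sum_sub_distrib, Finset.sum_neg_distrib,
      Finset.powerset_univ, ← Finset.compl_eq_univ_sdiff] at h
    rw [hW]
    simp only [W_vecCons_vecCons hZ, W_vecCons hZ, W_catSub hZ, P_eq_connected hZ,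
      Finset.sum_add_distrib]
    linear_combination h

end CircularEnsemble

end

open CircularEnsemble MeasureTheory Filter Topology
theorem proposition3p4 (V : ℂ → ℂ) (hV : IsPotential V) (κ : ℂ) (hκ : 0 < κ.re) (N : ℕ)
    (hZ : partitionZ V κ N ≠ 0) :
    -- the second loop equation
    (∀ z z₁ : ℂ, z ≠ 0 → z₁ ≠ 0 → ‖z‖ ≠ 1 → ‖z₁‖ ≠ 1 → z ≠ z₁ → DifferentiableAt ℂ V z →
      ∃ dW D L : ℂ,
        HasDerivAt (fun u => W V κ N ![u, z₁]) dW z ∧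
        HasDerivAt (fun t => kernel t z * (W V κ N ![t] - W V κ N ![z])) D z₁ ∧
        Tendsto (fun u => W V κ N ![u, z₁] / (2 * u)) (𝓝[≠] 0) (𝓝 L) ∧
        (κ - 1) * dW
          - 1 / 2 * κ * z⁻¹ * (W V κ N ![z, z, z₁] + 2 * W V κ N ![z] * W V κ N ![z, z₁])
          - P V κ N z ![z₁] - deriv V z * W V κ N ![z, z₁]
          - D
          + 1 / z₁ * kernel z₁ z * (W V κ N ![z₁] - W V κ N ![z])
          + (N - W V κ N ![z]) / z₁
          + (κ * (N - 1) + 1) * L = 0) ∧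
    -- the `(m+1)`-th loop equation, `m ≥ 2`
    (∀ m : ℕ, 2 ≤ m → ∀ (z : ℂ) (I : Fin m → ℂ), z ≠ 0 → ‖z‖ ≠ 1 →
      (∀ j, I j ≠ 0 ∧ ‖I j‖ ≠ 1 ∧ z ≠ I j) → DifferentiableAt ℂ V z →
      ∃ (dW : ℂ) (D : Fin m → ℂ) (L : ℂ),
        HasDerivAt (fun u => W V κ N (Matrix.vecCons u I)) dW z ∧
        (∀ j, HasDerivAt (fun t => kernel t z *
            (W V κ N (Function.update I j t) - W V κ N (catSub z I {j}ᶜ))) (D j) (I j)) ∧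
        Tendsto (fun u => W V κ N (Matrix.vecCons u I) / u) (𝓝[≠] 0) (𝓝 L) ∧
        (κ - 1) * dW
          - 1 / 2 * κ * z⁻¹ * (W V κ N (Matrix.vecCons z (Matrix.vecCons z I))
              + ∑ J : Finset (Fin m), W V κ N (catSub z I J) * W V κ N (catSub z I Jᶜ))
          - P V κ N z I - deriv V z * W V κ N (Matrix.vecCons z I)
          - ∑ j, D j
          + ∑ j, 1 / I j * kernel (I j) z * (W V κ N I - W V κ N (catSub z I {j}ᶜ))
          - ∑ j, 1 / I j * W V κ N (catSub z I {j}ᶜ)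
          + 1 / 2 * (κ * N + 1 - κ) * L = 0) := by
  refine ⟨fun z z₁ hz0 hz₁0 hz hz₁ hne hd => ?_, fun m hm z I hz0 hz hI hd => ?_⟩
  · obtain ⟨dW, D, L, hdW, hD, hL, heq⟩ := loop_equation hV hκ hZ (m := 1) le_rfl (I := ![z₁])
      hz0 hz (fun j => by simpa using ⟨hz₁0, hz₁, hne⟩) hd
    have hcompl : ({0}ᶜ : Finset (Fin 1)) = ∅ := rfl
    have hup : ∀ t, Function.update ![z₁] 0 t = ![t] := fun t => by
      ext i
      simp [Subsingleton.elim i 0]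
    have hcat : W V κ N (catSub z ![z₁] {0}ᶜ) = W V κ N ![z] := by
      rw [W_catSub hZ, W_singleton hZ ![z₁], hcompl]
    have hcat0 : W V κ N (catSub z ![z₁] ∅) = W V κ N ![z] := by
      rw [W_catSub hZ, W_singleton hZ ![z₁]]
    have hcat1 : W V κ N (catSub z ![z₁] Finset.univ) = W V κ N ![z, z₁] := by
      rw [W_catSub hZ, W_vecCons hZ]
    have hcat0' : W V κ N (catSub z ![z₁] ∅ᶜ) = W V κ N ![z, z₁] := by
      rw [W_catSub hZ, W_vecCons hZ, Finset.compl_empty]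
    have hcat1' : W V κ N (catSub z ![z₁] Finset.univᶜ) = W V κ N ![z] := by
      rw [W_catSub hZ, W_singleton hZ ![z₁], Finset.compl_univ]
    have hD0 := hD 0
    rw [hcat] at hD0
    simp only [hup] at hD0
    refine ⟨dW, D 0, L / 2, hdW, by simpa using hD0, ?_, ?_⟩
    · refine (hL.div_const 2).congr fun u => ?_
      rw [div_div, mul_comm]
    · have huniv : (Finset.univ : Finset (Finset (Fin 1))) = {∅, Finset.univ} := by decide
      -- The two subsets of a one-element string give the same product `W_1(z) W_2(z, z₁)`.
      rw [huniv, Finset.sum_pair (by decide)] at heq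
      simp only [hcat0, hcat1, hcat0', hcat1', Fin.sum_univ_one, hcat,
        Matrix.cons_val_zero, if_pos hcompl] at heq
      rw [← heq]
      ring
  · obtain ⟨dW, D, L, hdW, hD, hL, heq⟩ := loop_equation hV hκ hZ (by omega) hz0 hz hI hd
    refine ⟨dW, D, L, hdW, hD, hL, ?_⟩
    have hcompl : ∀ j : Fin m, ({j}ᶜ : Finset (Fin m)) ≠ ∅ := by
      intro j h
      have := congrArg Finset.card h
      rw [Finset.card_compl, Fintype.card_fin, Finset.card_singleton, Finset.card_empty] at this
      omega
    simp only [hcompl, if_false, mul_zero, Finset.sum_const_zero, add_zero] at heq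
    exact heq
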